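/- Let $R$ be a commutative ring with unit (for instance $\mathbb{Z}$), and let $\Lambda$ be the ring of symmetric functions over $R$ in $x_1,x_2,\dots$ (formal power series of bounded degree, with coefficients in $R$, invariant under all permutations of the variables). For a skew diagram $D$ let $s_D=\sum_T x^T$ be the skew Schur function, the sum over all semistandard tableaux $T$ of shape $D$; $s_\emptyset=1$. The content of the box in row $i$ and column $j$ is $j-i$. Let $\lambda/\mu$ be a (nonempty) edgewise connected skew diagram. A border strip is a nonempty connected skew diagram with no $2\times 2$ block of boxes; its initial box is the one of least content and its terminal box the one of greatest content. An outside decomposition $\Pi=(\theta_1,\dots,\theta_m)$ of $\lambda/\mu$ is a partition of its boxes into border strips such that the initial box of each $\theta_k$ lies on the left or bottom perimeter of $\lambda/\mu$ and its terminal box lies on the right or top perimeter. Let $p(\theta_k)$ and $q(\theta_k)$ be the contents of the initial and the terminal box of $\theta_k$. The cutting strip $\phi$ of $\Pi$ is the border strip (unique up to translation along the diagonal) that has exactly one box of each content occurring in $\lambda/\mu$ and satisfies the following rule: whenever boxes $a,b$ of $\lambda/\mu$ of contents $c,c+1$ share an edge, $a$ and $b$ lie in the same strip of $\Pi$ if and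 only if their relative position is that of the boxes of contents $c,c+1$ in $\phi$. For $p\le q$ let $\phi[p,q]$ be the segment of $\phi$ from content $p$ to content $q$; put $\phi[q+1,q]=\emptyset$, and for $p>q+1$ let $\phi[p,q]$ be undefined, with $s_{\phi[p,q]}=0$. The Giambelli type matrix of $\Pi$ is $$M(\Pi)=\bigl(s_{\phi[p(\theta_j),q(\theta_i)]}\bigr)_{i,j=1}^m .$$ Two matrices over a commutative ring, possibly of different sizes, are stably equivalent if each can be transformed into the other by a finite sequence of the operations $M\mapsto AM$ and $M\mapsto MA$ with $A$ invertible over the ring, $M\mapsto\begin{pmatrix}1&0\\0&M\end{pmatrix}$, and the inverse of the last operation. **Theorem.** For any two outside decompositions $\Pi$ and $\Pi'$ of the edgewise connected skew diagram $\lambda/\mu$, the matrices $M(\Pi)$ and $M(\Pi')$ have all their entries in $\Lambda$ and are stably equivalent over $\Lambda$. -/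

import Mathlib

/-! ### The ring of symmetric functions -/

/-- The ring `Λ` of symmetric functions with coefficients in `R`, in the variables
`x 0, x 1, x 2, …`: formal power series of bounded degree that are invariant under all
permutations of the variables. -/
def symmFunctions (R : Type*) [CommRing R] : Subring (MvPowerSeries ℕ R) where
  carrier := {f | (∀ σ : Equiv.Perm ℕ, MvPowerSeries.renameEquiv R σ f = f) ∧
    ∃ n : ℕ, ∀ α : ℕ →₀ ℕ, n < α.degree → MvPowerSeries.coeff α f = 0}
  zero_mem' := ⟨fun σ => map_zero _, 0, fun α _ => map_zero _⟩
  one_mem' := ⟨fun σ => map_one _, 0, fun α hα => by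
    classical
    rw [MvPowerSeries.coeff_one, if_neg]
    rintro rfl
    simp at hα⟩
  add_mem' := by
    rintro f g ⟨hf, n, hn⟩ ⟨hg, m, hm⟩
    refine ⟨fun σ => by rw [map_add, hf, hg], max n m, fun α hα => ?_⟩
    rw [map_add, hn α (lt_of_le_of_lt (le_max_left _ _) hα),
      hm α (lt_of_le_of_lt (le_max_right _ _) hα), add_zero]
  neg_mem' := by
    rintro f ⟨hf, n, hn⟩
    exact ⟨fun σ => by rw [map_neg, hf], n, fun α hα => by rw [map_neg, hn α hα, neg_zero]⟩
  mul_mem' := by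
    classical
    rintro f g ⟨hf, n, hn⟩ ⟨hg, m, hm⟩
    refine ⟨fun σ => by rw [map_mul, hf, hg], n + m, fun α hα => ?_⟩
    rw [MvPowerSeries.coeff_mul]
    refine Finset.sum_eq_zero fun p hp => ?_
    have h : p.1.degree + p.2.degree = α.degree := by
      rw [← map_add, Finset.HasAntidiagonal.mem_antidiagonal.1 hp]
    rcases Nat.lt_or_ge n p.1.degree with h1 | h1
    · rw [hn _ h1, zero_mul]
    · rw [hm _ (by omega), mul_zero]

/-! ### Stable equivalence of matrices -/

/-- The stabilization `(1 0; 0 M)` of a matrix `M`. -/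
def Matrix.stabilize {R : Type*} [CommRing R] {m n : ℕ} (M : Matrix (Fin m) (Fin n) R) :
    Matrix (Fin (m + 1)) (Fin (n + 1)) R :=
  Matrix.of (Fin.cons (Fin.cons 1 fun _ => 0) fun i => Fin.cons 0 fun j => M i j)

/-- Two matrices over `R`, possibly of different sizes, are stably equivalent if they can be
transformed into each other by a finite sequence of the operations `M ↦ A * M` and `M ↦ M * A` with
`A` invertible over `R`, stabilization, and the inverse of stabilization. -/
inductive StablyEquivalent {R : Type*} [CommRing R] : ∀ {m n m' n' : ℕ},
    Matrix (Fin m) (Fin n) R → Matrix (Fin m') (Fin n') R → Prop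
  | refl {m n : ℕ} (M : Matrix (Fin m) (Fin n) R) : StablyEquivalent M M
  | row {m n : ℕ} (M : Matrix (Fin m) (Fin n) R) (A : Matrix (Fin m) (Fin m) R) (hA : IsUnit A) :
      StablyEquivalent M (A * M)
  | col {m n : ℕ} (M : Matrix (Fin m) (Fin n) R) (A : Matrix (Fin n) (Fin n) R) (hA : IsUnit A) :
      StablyEquivalent M (M * A)
  | stabilize {m n : ℕ} (M : Matrix (Fin m) (Fin n) R) : StablyEquivalent M M.stabilize
  | destabilize {m n : ℕ} (M : Matrix (Fin m) (Fin n) R) : StablyEquivalent M.stabilize M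
  | trans {m n m' n' m'' n'' : ℕ} {M : Matrix (Fin m) (Fin n) R}
      {M' : Matrix (Fin m') (Fin n') R} {M'' : Matrix (Fin m'') (Fin n'') R} :
      StablyEquivalent M M' → StablyEquivalent M' M'' → StablyEquivalent M M''

/-- Stable equivalence over a subring `S` of `R`: the matrices `M` and `M'` have all their entries
in `S`, and as matrices over `S` they are stably equivalent. -/
def StablyEquivalentOver {R : Type*} [CommRing R] (S : Subring R) {m n m' n' : ℕ}
    (M : Matrix (Fin m) (Fin n) R) (M' : Matrix (Fin m') (Fin n') R) : Prop :=
  ∃ (N : Matrix (Fin m) (Fin n) S) (N' : Matrix (Fin m') (Fin n') S),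
    N.map Subtype.val = M ∧ N'.map Subtype.val = M' ∧ StablyEquivalent N N'

/-! ### Skew diagrams and border strips

A box is a pair `(i, j) : ℕ × ℕ`; `i` is the row (counted downwards) and `j` the column (counted
to the right), both starting from `0`. -/

/-- The content of the box in row `i` and column `j` is `j - i`. -/
def content (b : ℕ × ℕ) : ℤ := (b.2 : ℤ) - b.1

/-- Two boxes are adjacent if they share a common edge. -/
def boxGraph : SimpleGraph (ℕ × ℕ) :=
  SimpleGraph.fromRel fun a b => (a.1 = b.1 ∧ b.2 = a.2 + 1) ∨ (a.2 = b.2 ∧ b.1 = a.1 + 1)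

/-- The set of boxes of the skew diagram `λ/μ`, where `lam` is `λ` and `mu` is `μ`. -/
def skewCells (lam mu : YoungDiagram) : Finset (ℕ × ℕ) := lam.cells \ mu.cells

/-- `D` is the set of boxes of a skew diagram. -/
def IsSkewDiagram (D : Finset (ℕ × ℕ)) : Prop :=
  ∃ lam mu : YoungDiagram, mu ≤ lam ∧ D = skewCells lam mu

/-- `D` is nonempty and edgewise connected. -/
def EdgewiseConnected (D : Finset (ℕ × ℕ)) : Prop :=
  (boxGraph.induce (D : Set (ℕ × ℕ))).Connected

/-- A border strip is a (nonempty) connected skew diagram with no `2 × 2` block of boxes. -/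
structure IsBorderStrip (θ : Finset (ℕ × ℕ)) : Prop where
  isSkewDiagram : IsSkewDiagram θ
  connected : EdgewiseConnected θ
  no_block : ¬ ∃ i j : ℕ, (i, j) ∈ θ ∧ (i, j + 1) ∈ θ ∧ (i + 1, j) ∈ θ ∧ (i + 1, j + 1) ∈ θ

theorem IsBorderStrip.nonempty {θ : Finset (ℕ × ℕ)} (h : IsBorderStrip θ) : θ.Nonempty := by
  obtain ⟨x, hx⟩ := h.connected.nonempty
  exact ⟨x, hx⟩

/-! ### Skew Schur functions -/

/-- `T` is a semistandard tableau of shape `D`: weakly increasing along rows (from left to right)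
and strictly increasing down columns. -/
def IsSemistandard (D : Finset (ℕ × ℕ)) (T : D → ℕ) : Prop :=
  (∀ a b : D, a.1.1 = b.1.1 → a.1.2 < b.1.2 → T a ≤ T b) ∧
    ∀ a b : D, a.1.2 = b.1.2 → a.1.1 < b.1.1 → T a < T b

/-- The skew Schur function of the shape `D`: the coefficient of the monomial `x ^ α` is the number
of semistandard tableaux of shape `D` in which each `k` occurs exactly `α k` times. -/
noncomputable def skewSchur (R : Type*) [CommRing R] (D : Finset (ℕ × ℕ)) : MvPowerSeries ℕ R :=
  fun α => ((Set.ncard {T : D → ℕ | IsSemistandard D T ∧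
    ∀ k : ℕ, (Finset.univ.filter fun b => T b = k).card = α k} : ℕ) : R)

/-! ### Outside decompositions -/

/-- The box `b` of `D` lies on the left perimeter or on the bottom perimeter of `D`: there is no
box of `D` immediately to the left of `b`, or there is none immediately below `b`. -/
def OnLeftOrBottom (D : Finset (ℕ × ℕ)) (b : ℕ × ℕ) : Prop :=
  b ∈ D ∧ ((∀ j : ℕ, j + 1 = b.2 → (b.1, j) ∉ D) ∨ (b.1 + 1, b.2) ∉ D)

/-- The box `b` of `D` lies on the right perimeter or on the top perimeter of `D`: there is no
box of `D` immediately to the right of `b`, or there is none immediately above `b`. -/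
def OnRightOrTop (D : Finset (ℕ × ℕ)) (b : ℕ × ℕ) : Prop :=
  b ∈ D ∧ ((b.1, b.2 + 1) ∉ D ∨ ∀ i : ℕ, i + 1 = b.1 → (i, b.2) ∉ D)

/-- An outside decomposition `P = (θ₁, …, θₘ)` of `D`: a partition of the boxes of `D` into border
strips, each of which has its initial box (lower left end, the box of least content) on the left or
bottom perimeter of `D` and its terminal box (upper right end, the box of greatest content) on the
right or top perimeter of `D`. -/
structure OutsideDecomposition (D : Finset (ℕ × ℕ)) where
  /-- the number of strips -/
  m : ℕ
  /-- the strips -/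
  strip : Fin m → Finset (ℕ × ℕ)
  isBorderStrip : ∀ k, IsBorderStrip (strip k)
  disjoint : ∀ k l, k ≠ l → Disjoint (strip k) (strip l)
  cover : Finset.univ.biUnion strip = D
  initial_box : ∀ k, ∀ b ∈ strip k, (∀ c ∈ strip k, content b ≤ content c) → OnLeftOrBottom D b
  terminal_box : ∀ k, ∀ b ∈ strip k, (∀ c ∈ strip k, content c ≤ content b) → OnRightOrTop D b

/-- `p(θ)`, the content of the initial box of the strip `θ = P.strip k`. -/
def OutsideDecomposition.initContent {D : Finset (ℕ × ℕ)} (P : OutsideDecomposition D)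
    (k : Fin P.m) : ℤ :=
  (P.strip k).inf' (P.isBorderStrip k).nonempty content

/-- `q(θ)`, the content of the terminal box of the strip `θ = P.strip k`. -/
def OutsideDecomposition.termContent {D : Finset (ℕ × ℕ)} (P : OutsideDecomposition D)
    (k : Fin P.m) : ℤ :=
  (P.strip k).sup' (P.isBorderStrip k).nonempty content

/-- The boxes `a` and `b` lie in a common strip of `P`. -/
def OutsideDecomposition.Joined {D : Finset (ℕ × ℕ)} (P : OutsideDecomposition D)
    (a b : ℕ × ℕ) : Prop :=
  ∃ k, a ∈ P.strip k ∧ b ∈ P.strip k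

/-- The position of `b` relative to `a` is the same as that of `b'` relative to `a'`. -/
def SameRelativePosition (a b a' b' : ℕ × ℕ) : Prop :=
  (b.1 : ℤ) - a.1 = (b'.1 : ℤ) - a'.1 ∧ (b.2 : ℤ) - a.2 = (b'.2 : ℤ) - a'.2

/-- `φ` is the cutting strip of the outside decomposition `P` of `D`. It is a border strip with one
box on each diagonal of `D` (it is placed in the plane so that contents agree, which determines it
up to translation along the diagonal). If two boxes of `D` on consecutive diagonals share an edge,
then they belong to the same strip of `P` exactly when their relative position is that of the two
boxes of `φ` on these diagonals. (Usually the "only if" part of this rule determines `φ`. The "if"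
part matters only if no strip of `P` meets both diagonals: then each of the two diagonals consists
of a single box, the two boxes share an edge but lie in different strips, and `φ` has the other
direction there.) -/
structure IsCuttingStrip {D : Finset (ℕ × ℕ)} (P : OutsideDecomposition D)
    (φ : Finset (ℕ × ℕ)) : Prop where
  isBorderStrip : IsBorderStrip φ
  contents : φ.image content = D.image content
  rule : ∀ a ∈ D, ∀ b ∈ D, boxGraph.Adj a b → content b = content a + 1 →
    ∀ a' ∈ φ, ∀ b' ∈ φ, content a' = content a → content b' = content b →
      (P.Joined a b ↔ SameRelativePosition a b a' b')

/-- For `p ≤ q` the segment `φ[p, q]` of the strip `φ`; it is empty if `p = q + 1`. -/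
def stripSegment (φ : Finset (ℕ × ℕ)) (p q : ℤ) : Finset (ℕ × ℕ) :=
  φ.filter fun b => p ≤ content b ∧ content b ≤ q

/-- `s_{φ[p, q]}`, which is `0` if `φ[p, q]` is undefined, that is, if `p > q + 1`. -/
noncomputable def segmentSchur (R : Type*) [CommRing R] (φ : Finset (ℕ × ℕ)) (p q : ℤ) :
    MvPowerSeries ℕ R :=
  if p ≤ q + 1 then skewSchur R (stripSegment φ p q) else 0

/-- The Giambelli type matrix `M(P)`, with entry `s_{φ[p(θⱼ), q(θᵢ)]}` in row `i` and column `j`,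
where `φ` is the cutting strip of `P`. -/
noncomputable def giambelliMatrix (R : Type*) [CommRing R] {D : Finset (ℕ × ℕ)}
    (P : OutsideDecomposition D) (φ : Finset (ℕ × ℕ)) :
    Matrix (Fin P.m) (Fin P.m) (MvPowerSeries ℕ R) :=
  Matrix.of fun i j => segmentSchur R φ (P.initContent j) (P.termContent i)

/-! ### Every outside decomposition of a connected skew diagram has a cutting strip -/

theorem IsSkewDiagram.convex {D : Finset (ℕ × ℕ)} (hD : IsSkewDiagram D) {a b c : ℕ × ℕ}
    (ha : a ∈ D) (hc : c ∈ D) (hab : a ≤ b) (hbc : b ≤ c) : b ∈ D := by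
  obtain ⟨lam, mu, -, rfl⟩ := hD
  simp only [skewCells, Finset.mem_sdiff] at *
  exact ⟨lam.isLowerSet hbc hc.1, fun h => ha.2 (mu.isLowerSet hab h)⟩

theorem isSkewDiagram_of_convex {D : Finset (ℕ × ℕ)}
    (h : ∀ a b c : ℕ × ℕ, a ∈ D → c ∈ D → a ≤ b → b ≤ c → b ∈ D) : IsSkewDiagram D := by
  classical
  let L : Finset (ℕ × ℕ) := D.biUnion Finset.Iic
  have hL : ∀ x, x ∈ L ↔ ∃ c ∈ D, x ≤ c := by simp [L]
  refine ⟨⟨L, ?_⟩, ⟨L \ D, ?_⟩, ?_, ?_⟩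
  · intro x y hyx hx
    simp only [Finset.mem_coe, hL] at *
    obtain ⟨c, hc, hxc⟩ := hx
    exact ⟨c, hc, hyx.trans hxc⟩
  · intro x y hyx hx
    simp only [Finset.mem_coe, Finset.mem_sdiff, hL] at *
    obtain ⟨⟨c, hc, hxc⟩, hx⟩ := hx
    exact ⟨⟨c, hc, hyx.trans hxc⟩, fun hy => hx (h y x c hy hc hyx hxc)⟩
  · intro x hx
    exact (Finset.mem_sdiff.1 hx).1
  · ext x
    simp only [skewCells, Finset.mem_sdiff, hL]
    constructor
    · exact fun hx => ⟨⟨x, hx, le_rfl⟩, fun hh => hh.2 hx⟩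
    · rintro ⟨h1, h2⟩
      by_contra hx
      exact h2 ⟨h1, hx⟩

theorem boxGraph_adj_iff {a b : ℕ × ℕ} : boxGraph.Adj a b ↔
    (a.1 = b.1 ∧ (b.2 = a.2 + 1 ∨ a.2 = b.2 + 1)) ∨
      (a.2 = b.2 ∧ (b.1 = a.1 + 1 ∨ a.1 = b.1 + 1)) := by
  rcases a with ⟨x, y⟩
  rcases b with ⟨u, v⟩
  simp only [boxGraph, SimpleGraph.fromRel_adj, ne_eq, Prod.mk.injEq]
  omega

theorem EdgewiseConnected.exists_step {D : Finset (ℕ × ℕ)} (hD : EdgewiseConnected D)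
    {a c : ℕ × ℕ} (ha : a ∈ D) (hc : c ∈ D) {n : ℤ} (h1 : content a ≤ n) (h2 : n < content c) :
    ∃ u ∈ D, ∃ v ∈ D, boxGraph.Adj u v ∧ content u = n ∧ content v = n + 1 := by
  obtain ⟨w⟩ := hD.preconnected ⟨a, ha⟩ ⟨c, hc⟩
  obtain ⟨d, -, hd1, hd2⟩ := w.exists_boundary_dart {x | content x.1 ≤ n} h1 (by simpa using h2)
  have hadj : boxGraph.Adj d.fst.1 d.snd.1 := d.adj
  refine ⟨d.fst.1, d.fst.2, d.snd.1, d.snd.2, hadj, ?_⟩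
  rw [boxGraph_adj_iff] at hadj
  simp only [Set.mem_ofPred_eq, content] at *
  omega

theorem IsBorderStrip.content_injOn {θ : Finset (ℕ × ℕ)} (h : IsBorderStrip θ) {a b : ℕ × ℕ}
    (ha : a ∈ θ) (hb : b ∈ θ) (hab : content a = content b) : a = b := by
  have key : ∀ a b : ℕ × ℕ, a ∈ θ → b ∈ θ → content a = content b → ¬ a.1 < b.1 := by
    rintro ⟨x, y⟩ ⟨u, v⟩ ha hb hab hlt
    simp only [content] at hab hlt
    have hc : ∀ s t : ℕ, x ≤ s → y ≤ t → s ≤ x + 1 → t ≤ y + 1 → (s, t) ∈ θ := fun s t _ _ _ _ =>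
      h.isSkewDiagram.convex ha hb (Prod.mk_le_mk.2 ⟨by omega, by omega⟩)
        (Prod.mk_le_mk.2 ⟨by omega, by omega⟩)
    exact h.no_block ⟨x, y, ha, hc _ _ (by omega) (by omega) (by omega) (by omega),
      hc _ _ (by omega) (by omega) (by omega) (by omega),
      hc _ _ (by omega) (by omega) (by omega) (by omega)⟩
  have h1 := key a b ha hb hab
  have h2 := key b a hb ha hab.symm
  simp only [content] at hab
  ext <;> omega

namespace OutsideDecomposition

variable {D : Finset (ℕ × ℕ)} (P : OutsideDecomposition D)

theorem exists_strip {a : ℕ × ℕ} (ha : a ∈ D) : ∃ k, a ∈ P.strip k := by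
  rw [← P.cover] at ha
  simpa using ha

theorem strip_unique {a : ℕ × ℕ} {k l : Fin P.m} (hk : a ∈ P.strip k) (hl : a ∈ P.strip l) :
    k = l := by
  by_contra h
  exact Finset.disjoint_left.1 (P.disjoint k l h) hk hl

theorem joined_right_iff {x y : ℕ} (h1 : (x + 1, y) ∈ D) (h2 : (x, y) ∈ D)
    (h3 : (x + 1, y + 1) ∈ D) :
    P.Joined (x + 1, y) (x, y) ↔ ¬ P.Joined (x + 1, y) (x + 1, y + 1) := by
  constructor
  · rintro ⟨k, hk1, hk2⟩ ⟨l, hl1, hl2⟩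
    obtain rfl := P.strip_unique hk1 hl1
    have := (P.isBorderStrip k).content_injOn hk2 hl2 (by simp [content])
    simp at this
  · intro hn
    obtain ⟨k, hk⟩ := P.exists_strip h1
    have hnm : ¬ ∀ c ∈ P.strip k, content c ≤ content (x + 1, y) := fun hh => by
      rcases (P.terminal_box k _ hk hh).2 with h | h
      · exact h h3
      · exact h x rfl h2
    push Not at hnm
    obtain ⟨c, hc, hlt⟩ := hnm
    obtain ⟨u, hu, v, hv, hadj, hu', hv'⟩ :=
      (P.isBorderStrip k).connected.exists_step hk hc le_rfl hlt
    obtain rfl := (P.isBorderStrip k).content_injOn hu hk hu'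
    rw [boxGraph_adj_iff] at hadj
    rcases v with ⟨s, t⟩
    simp only [content] at hadj hv'
    have hv2 : (s = x ∧ t = y) ∨ (s = x + 1 ∧ t = y + 1) := by omega
    rcases hv2 with ⟨rfl, rfl⟩ | ⟨rfl, rfl⟩
    · exact ⟨k, hk, hv⟩
    · exact absurd ⟨k, hk, hv⟩ hn

theorem joined_left_iff {x y : ℕ} (h1 : (x, y + 1) ∈ D) (h2 : (x, y) ∈ D)
    (h3 : (x + 1, y + 1) ∈ D) :
    P.Joined (x + 1, y + 1) (x, y + 1) ↔ ¬ P.Joined (x, y) (x, y + 1) := by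
  constructor
  · rintro ⟨k, hk1, hk2⟩ ⟨l, hl1, hl2⟩
    obtain rfl := P.strip_unique hk2 hl2
    have := (P.isBorderStrip k).content_injOn hk1 hl1 (by simp [content])
    simp at this
  · intro hn
    obtain ⟨k, hk⟩ := P.exists_strip h1
    have hnm : ¬ ∀ c ∈ P.strip k, content (x, y + 1) ≤ content c := fun hh => by
      rcases (P.initial_box k _ hk hh).2 with h | h
      · exact h y rfl h2
      · exact h h3
    push Not at hnm
    obtain ⟨c, hc, hlt⟩ := hnm
    obtain ⟨u, hu, v, hv, hadj, hu', hv'⟩ :=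
      (P.isBorderStrip k).connected.exists_step (n := content (x, y + 1) - 1) hc hk
        (by omega) (by omega)
    obtain rfl := (P.isBorderStrip k).content_injOn hv hk (by omega)
    rw [boxGraph_adj_iff] at hadj
    rcases u with ⟨s, t⟩
    simp only [content] at hadj hu'
    have hv2 : (s = x ∧ t = y) ∨ (s = x + 1 ∧ t = y + 1) := by omega
    rcases hv2 with ⟨rfl, rfl⟩ | ⟨rfl, rfl⟩
    · exact absurd ⟨k, hu, hk⟩ hn
    · exact ⟨k, hu, hk⟩

variable {P} in
theorem up_up (hD : IsSkewDiagram D) {x y : ℕ} (k : ℕ) (_h1 : (x + 1, y) ∈ D) (h2 : (x, y) ∈ D)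
    (h3 : (x + k + 1, y + k) ∈ D) :
    P.Joined (x + 1, y) (x, y) ↔ P.Joined (x + k + 1, y + k) (x + k, y + k) := by
  have hc : ∀ s t : ℕ, x ≤ s → y ≤ t → s ≤ x + k + 1 → t ≤ y + k → (s, t) ∈ D := fun s t _ _ _ _ =>
    hD.convex h2 h3 (Prod.mk_le_mk.2 ⟨by omega, by omega⟩)
      (Prod.mk_le_mk.2 ⟨by omega, by omega⟩)
  have key : ∀ j ≤ k, (P.Joined (x + 1, y) (x, y) ↔
      P.Joined (x + j + 1, y + j) (x + j, y + j)) := by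
    intro j
    induction j with
    | zero => simp
    | succ j ih =>
      intro hj
      rw [ih (by omega), P.joined_right_iff (hc _ _ (by omega) (by omega) (by omega) (by omega))
        (hc _ _ (by omega) (by omega) (by omega) (by omega))
        (hc _ _ (by omega) (by omega) (by omega) (by omega))]
      have := P.joined_left_iff (x := x + j + 1) (y := y + j)
        (hc _ _ (by omega) (by omega) (by omega) (by omega))
        (hc _ _ (by omega) (by omega) (by omega) (by omega))
        (hc _ _ (by omega) (by omega) (by omega) (by omega))
      exact this.symm
  exact key k le_rfl

variable {P} in
theorem up_iff_up (hD : IsSkewDiagram D) {x y u v : ℕ} (h1 : (x + 1, y) ∈ D) (h2 : (x, y) ∈ D)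
    (h3 : (u + 1, v) ∈ D) (h4 : (u, v) ∈ D) (hc : content (x, y) = content (u, v)) :
    P.Joined (x + 1, y) (x, y) ↔ P.Joined (u + 1, v) (u, v) := by
  simp only [content] at hc
  rcases le_total x u with h | h
  · obtain ⟨k, rfl⟩ := Nat.exists_eq_add_of_le h
    obtain rfl : v = y + k := by omega
    exact up_up hD k h1 h2 h3
  · obtain ⟨k, rfl⟩ := Nat.exists_eq_add_of_le h
    obtain rfl : y = v + k := by omega
    exact (up_up hD k h3 h4 h1).symm

variable {P} in
theorem up_iff_not_right (hD : IsSkewDiagram D) {x y u v : ℕ} (h1 : (x + 1, y) ∈ D)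
    (h2 : (x, y) ∈ D) (h3 : (u, v) ∈ D) (h4 : (u, v + 1) ∈ D)
    (hc : content (x + 1, y) = content (u, v)) :
    P.Joined (x + 1, y) (x, y) ↔ ¬ P.Joined (u, v) (u, v + 1) := by
  simp only [content] at hc
  rcases Nat.lt_or_ge x u with h | h
  · obtain ⟨k, rfl⟩ := Nat.exists_eq_add_of_le (Nat.succ_le_of_lt h)
    obtain rfl : v = y + k := by omega
    have e : x.succ + k = (x + k) + 1 := by omega
    rw [e] at h3 h4 ⊢
    have h5 : (x + k, y + k) ∈ D := hD.convex h2 h3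
      (Prod.mk_le_mk.2 ⟨by omega, by omega⟩) (Prod.mk_le_mk.2 ⟨by omega, by omega⟩)
    rw [up_up hD k h1 h2 h3]
    exact P.joined_right_iff h3 h5 h4
  · have h5 : (u + 1, v + 1) ∈ D := hD.convex h3 h1
      (Prod.mk_le_mk.2 ⟨by omega, by omega⟩) (Prod.mk_le_mk.2 ⟨by omega, by omega⟩)
    rw [up_iff_up hD h1 h2 h5 h4 (by simp only [content]; omega)]
    exact P.joined_left_iff h4 h3 h5

variable {P} in
theorem right_iff_right (hD : IsSkewDiagram D) {x y u v : ℕ} (h1 : (x, y) ∈ D)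
    (h2 : (x, y + 1) ∈ D) (h3 : (u, v) ∈ D) (h4 : (u, v + 1) ∈ D)
    (hc : content (x, y) = content (u, v)) :
    P.Joined (x, y) (x, y + 1) ↔ P.Joined (u, v) (u, v + 1) := by
  have key : ∀ x y u v : ℕ, (x, y) ∈ D → (x, y + 1) ∈ D → (u, v) ∈ D → (u, v + 1) ∈ D →
      content (x, y) = content (u, v) → x < u →
      (P.Joined (x, y) (x, y + 1) ↔ P.Joined (u, v) (u, v + 1)) := by
    intro x y u v h1 h2 h3 h4 hc hlt
    simp only [content] at hc
    have h5 : (x + 1, y + 1) ∈ D := hD.convex h1 h3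
      (Prod.mk_le_mk.2 ⟨by omega, by omega⟩) (Prod.mk_le_mk.2 ⟨by omega, by omega⟩)
    have e1 := up_iff_not_right (P := P) hD h5 h2 h1 h2 (by simp only [content]; omega)
    have e2 := up_iff_not_right (P := P) hD h5 h2 h3 h4 (by simp only [content]; omega)
    tauto
  rcases lt_trichotomy x u with h | rfl | h
  · exact key x y u v h1 h2 h3 h4 hc h
  · simp only [content] at hc
    obtain rfl : y = v := by omega
    rfl
  · exact (key u v x y h3 h4 h1 h2 hc.symm h).symm

/-- The common direction of the boxes of content `c` is up. -/
def GoesUp (c : ℤ) : Prop :=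
  (∃ x y : ℕ, (x + 1, y) ∈ D ∧ (x, y) ∈ D ∧ content (x + 1, y) = c ∧
      P.Joined (x + 1, y) (x, y)) ∨
    ∃ x y : ℕ, (x, y) ∈ D ∧ (x, y + 1) ∈ D ∧ content (x, y) = c ∧ ¬ P.Joined (x, y) (x, y + 1)

variable {P} in
theorem joined_up_iff (hD : IsSkewDiagram D) {x y : ℕ} (h1 : (x + 1, y) ∈ D) (h2 : (x, y) ∈ D) :
    P.Joined (x + 1, y) (x, y) ↔ P.GoesUp (content (x + 1, y)) := by
  constructor
  · exact fun h => Or.inl ⟨x, y, h1, h2, rfl, h⟩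
  · rintro (⟨u, v, h3, h4, hc, h⟩ | ⟨u, v, h3, h4, hc, h⟩)
    · exact (up_iff_up hD h1 h2 h3 h4 (by simp only [content] at *; omega)).2 h
    · exact (up_iff_not_right hD h1 h2 h3 h4 hc.symm).2 h

variable {P} in
theorem joined_right_iff_not (hD : IsSkewDiagram D) {x y : ℕ} (h1 : (x, y) ∈ D)
    (h2 : (x, y + 1) ∈ D) :
    P.Joined (x, y) (x, y + 1) ↔ ¬ P.GoesUp (content (x, y)) := by
  constructor
  · rintro h (⟨u, v, h3, h4, hc, h'⟩ | ⟨u, v, h3, h4, hc, h'⟩)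
    · exact (up_iff_not_right hD h3 h4 h1 h2 hc).1 h' h
    · exact h' ((right_iff_right hD h1 h2 h3 h4 hc.symm).1 h)
  · intro h
    by_contra hn
    exact h (Or.inr ⟨x, y, h1, h2, rfl, hn⟩)

end OutsideDecomposition

/-- Given directions on an interval of contents, there is a border strip with these directions. -/
theorem exists_borderStrip (U : ℤ → Prop) {p q : ℤ} (hpq : p ≤ q) :
    ∃ φ : Finset (ℕ × ℕ), IsBorderStrip φ ∧ φ.image content = Finset.Icc p q ∧
      ∀ a ∈ φ, ∀ b ∈ φ, content b = content a + 1 →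
        (U (content a) → a.1 = b.1 + 1 ∧ a.2 = b.2) ∧
          (¬ U (content a) → a.1 = b.1 ∧ b.2 = a.2 + 1) := by
  classical
  let r : ℤ → ℕ := fun c => (-p).toNat + ((Finset.Ico c q).filter U).card
  let f : ℤ → ℕ × ℕ := fun c => (r c, ((r c : ℤ) + c).toNat)
  have hr : ∀ c d : ℤ, c ≤ d → d ≤ q → r d ≤ r c ∧ (r c : ℤ) + c ≤ r d + d := by
    intro c d hcd hdq
    have hsplit : (Finset.Ico c q).filter U =
        (Finset.Ico c d).filter U ∪ (Finset.Ico d q).filter U := by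
      rw [← Finset.filter_union, Finset.Ico_union_Ico_eq_Ico hcd hdq]
    have h1 : ((Finset.Ico c q).filter U).card ≤
        ((Finset.Ico c d).filter U).card + ((Finset.Ico d q).filter U).card := by
      rw [hsplit]; exact Finset.card_union_le _ _
    have h2 : ((Finset.Ico c d).filter U).card ≤ (d - c).toNat := by
      rw [← Int.card_Ico]; exact Finset.card_filter_le _ _
    have h3 : ((Finset.Ico d q).filter U).card ≤ ((Finset.Ico c q).filter U).card := by
      rw [hsplit]; exact Finset.card_le_card Finset.subset_union_right
    simp only [r]
    push_cast
    omega
  have hstep : ∀ c : ℤ, c < q → (U c → r c = r (c + 1) + 1) ∧ (¬ U c → r c = r (c + 1)) := by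
    intro c hc
    have hins : Finset.Ico c q = insert c (Finset.Ico (c + 1) q) := by
      ext z; simp only [Finset.mem_Ico, Finset.mem_insert]; omega
    constructor
    · intro h
      simp only [r]
      rw [hins, Finset.filter_insert, if_pos h, Finset.card_insert_of_notMem (by simp)]
      omega
    · intro h
      simp only [r]
      rw [hins, Finset.filter_insert, if_neg h]
  have hpos : ∀ c : ℤ, p ≤ c → 0 ≤ (r c : ℤ) + c := by
    intro c hc
    simp only [r]
    push_cast
    omega
  have hf1 : ∀ c, (f c).1 = r c := fun _ => rfl
  have hf2 : ∀ c, p ≤ c → ((f c).2 : ℤ) = r c + c := fun c hc => Int.toNat_of_nonneg (hpos c hc)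
  have hcont : ∀ c, p ≤ c → content (f c) = c := by
    intro c hc
    simp only [content, hf1, hf2 c hc]
    omega
  have hmem : ∀ b, b ∈ (Finset.Icc p q).image f ↔ ∃ c, p ≤ c ∧ c ≤ q ∧ f c = b := by
    intro b; simp [and_assoc]
  have hadj : ∀ c, p ≤ c → c < q → boxGraph.Adj (f c) (f (c + 1)) := by
    intro c hc hcq
    have h1 := hf2 c hc
    have h2 := hf2 (c + 1) (by omega)
    have h3 := hstep c hcq
    rw [boxGraph_adj_iff, hf1, hf1]
    by_cases h : U c
    · have := h3.1 h; omega
    · have := h3.2 h; omega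
  refine ⟨(Finset.Icc p q).image f, ⟨?_, ?_, ?_⟩, ?_, ?_⟩
  · refine isSkewDiagram_of_convex ?_
    rintro ⟨x, y⟩ ⟨s, t⟩ ⟨u, v⟩ ha hc hab hbc
    rw [hmem] at ha hc ⊢
    obtain ⟨c, hc1, hc2, hc3⟩ := ha
    obtain ⟨d, hd1, hd2, hd3⟩ := hc
    have e1 := hf2 c hc1
    have e2 := hf2 d hd1
    have e3 := hf1 c
    have e4 := hf1 d
    rw [hc3] at e1 e3
    rw [hd3] at e2 e4
    simp only [Prod.mk_le_mk] at *
    have hfe : ∀ e : ℤ, p ≤ e → r e = s → (r e : ℤ) + e = t → f e = (s, t) := by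
      intro e he h1 h2
      have := hf2 e he
      ext
      · exact h1
      · simp only; omega
    refine ⟨(t : ℤ) - s, ?_⟩
    rcases le_total c d with h | h
    · have k1 := hr c d h hd2
      have k2 := hr c (t - s) (by omega) (by omega)
      have k3 := hr (t - s) d (by omega) (by omega)
      exact ⟨by omega, by omega, hfe _ (by omega) (by omega) (by omega)⟩
    · have k1 := hr d c h hc2
      have k2 := hr d (t - s) (by omega) (by omega)
      have k3 := hr (t - s) c (by omega) (by omega)
      exact ⟨by omega, by omega, hfe _ (by omega) (by omega) (by omega)⟩
  · have hin : ∀ c, p ≤ c → c ≤ q →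
        f c ∈ (((Finset.Icc p q).image f : Finset (ℕ × ℕ)) : Set (ℕ × ℕ)) :=
      fun c h1 h2 => Finset.mem_coe.2 ((hmem _).2 ⟨c, h1, h2, rfl⟩)
    rw [EdgewiseConnected, SimpleGraph.connected_iff_exists_forall_reachable]
    refine ⟨⟨f p, hin p le_rfl hpq⟩, ?_⟩
    have key : ∀ n : ℕ, ∀ h : p + n ≤ q,
        (boxGraph.induce (((Finset.Icc p q).image f : Finset (ℕ × ℕ)) : Set (ℕ × ℕ))).Reachable
          ⟨f p, hin p le_rfl hpq⟩ ⟨f (p + n), hin _ (by omega) h⟩ := by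
      intro n
      induction n with
      | zero =>
        intro h
        have : (⟨f p, hin p le_rfl hpq⟩ : {x // x ∈ (((Finset.Icc p q).image f :
            Finset (ℕ × ℕ)) : Set (ℕ × ℕ))}) = ⟨f (p + (0 : ℕ)), hin _ (by omega) h⟩ := by
          simp
        rw [← this]
      | succ n ih =>
        intro h
        refine (ih (by omega)).trans (SimpleGraph.Adj.reachable ?_)
        have := hadj (p + n) (by omega) (by omega)
        simp only [SimpleGraph.induce_adj]
        have e : p + ((n + 1 : ℕ) : ℤ) = p + n + 1 := by push_cast; ring
        rw [e]
        exact this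
    rintro ⟨b, hb⟩
    obtain ⟨c, hc1, hc2, rfl⟩ := (hmem b).1 (Finset.mem_coe.1 hb)
    obtain ⟨n, hn⟩ := Int.eq_ofNat_of_zero_le (sub_nonneg.2 hc1)
    obtain rfl : c = p + n := by omega
    exact key n hc2
  · rintro ⟨i, j, h1, -, -, h4⟩
    rw [hmem] at h1 h4
    obtain ⟨c, hc1, -, hc⟩ := h1
    obtain ⟨d, hd1, -, hd⟩ := h4
    have e1 := hcont c hc1
    have e2 := hcont d hd1
    rw [hc] at e1
    rw [hd] at e2
    simp only [content] at e1 e2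
    obtain rfl : c = d := by push_cast at e2; omega
    rw [hc] at hd
    simp at hd
  · ext c
    simp only [Finset.mem_image, Finset.mem_Icc]
    constructor
    · rintro ⟨b, ⟨d, hd, rfl⟩, rfl⟩
      rwa [hcont d hd.1]
    · intro h
      exact ⟨f c, ⟨c, h, rfl⟩, hcont c h.1⟩
  · intro a ha b hb hab
    rw [hmem] at ha hb
    obtain ⟨c, hc1, hc2, rfl⟩ := ha
    obtain ⟨d, hd1, hd2, rfl⟩ := hb
    rw [hcont c hc1, hcont d hd1] at hab
    subst hab
    rw [hcont c hc1, hf1, hf1]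
    have h1 := hf2 c hc1
    have h2 := hf2 (c + 1) hd1
    have h3 := hstep c (by omega)
    constructor
    · intro h; have := h3.1 h; omega
    · intro h; have := h3.2 h; omega

/-- Every outside decomposition of an edgewise connected skew diagram has a cutting strip. -/
theorem exists_isCuttingStrip {D : Finset (ℕ × ℕ)} (hD : IsSkewDiagram D)
    (hc : EdgewiseConnected D) (P : OutsideDecomposition D) : ∃ φ, IsCuttingStrip P φ := by
  obtain ⟨⟨x₀, hx₀⟩⟩ := hc.nonempty
  have hne : D.Nonempty := ⟨x₀, hx₀⟩
  obtain ⟨a₀, ha₀, hmin⟩ := D.exists_min_image content hne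
  obtain ⟨b₀, hb₀, hmax⟩ := D.exists_max_image content hne
  obtain ⟨φ, hφ, hcont, hdir⟩ := exists_borderStrip P.GoesUp (hmin b₀ hb₀)
  refine ⟨φ, hφ, ?_, ?_⟩
  · rw [hcont]
    ext n
    simp only [Finset.mem_Icc, Finset.mem_image]
    constructor
    · rintro ⟨h1, h2⟩
      rcases h2.lt_or_eq with h | h
      · obtain ⟨u, hu, -, -, -, hu', -⟩ := hc.exists_step ha₀ hb₀ h1 h
        exact ⟨u, hu, hu'⟩
      · exact ⟨b₀, hb₀, h.symm⟩
    · rintro ⟨b, hb, rfl⟩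
      exact ⟨hmin b hb, hmax b hb⟩
  · rintro ⟨x, y⟩ ha ⟨u, v⟩ hb hadj hab a' ha' b' hb' haa' hbb'
    have hd := hdir a' ha' b' hb' (by omega)
    rw [haa'] at hd
    rw [boxGraph_adj_iff] at hadj
    simp only [content] at hab hadj
    have hcase : (x = u + 1 ∧ y = v) ∨ (u = x ∧ v = y + 1) := by omega
    rcases hcase with ⟨rfl, rfl⟩ | ⟨rfl, rfl⟩
    · rw [OutsideDecomposition.joined_up_iff hD ha hb]
      simp only [SameRelativePosition]
      constructor
      · intro h; have := hd.1 h; push_cast; omega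
      · intro h
        by_contra hn
        have := hd.2 hn
        push_cast at h
        omega
    · rw [OutsideDecomposition.joined_right_iff_not hD ha hb]
      simp only [SameRelativePosition]
      constructor
      · intro h; have := hd.2 h; push_cast; omega
      · intro h hn
        have := hd.1 hn
        push_cast at h
        omega

/-!
The cutting strip of an outside decomposition is a word in the steps "up" and "right", indexed by
the contents of the diagram, and the Giambelli type matrix depends only on this word: its columns
belong to the boxes of the diagram that have no predecessor in the direction prescribed by the word,
its rows to the boxes that have no successor (`exists_stablyEquivalent_wordMatrix`). This description
makes sense for every word, whether or not it comes from an outside decomposition, so any two words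
can be connected by changing one letter at a time, and it suffices to see that the stable equivalence
class does not change when one letter does (`wordMatrix_insert`).

For the entries, let `T p q` be the ribbon Schur function of the segment with contents
`p, …, q - 1`. A pair of fillings of two segments that meet between the contents `c` and `c + 1` is
a filling of the ribbon with either step there, so that changing the letter at `c` replaces `T p q`
by `T p d * T d q - T p q` for `p < d < q`, where `d = c + 1`, and fixes all other entries
(`ribbonSchur_mul`). This also shows that ribbon Schur functions are polynomials in the complete
homogeneous symmetric functions, hence symmetric (`ribbonSchur_mem`).

For the index sets, the boxes on the diagonals `c` and `c + 1` form an alternating chain of steps up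
and steps to the right. Therefore only membership of `d` changes, and `d` is an initial content for
one letter if and only if it is not a terminal content for the other
(`mem_initialContents_insert`, `mem_terminalContents_insert`). There are two cases. If `d` belongs to
exactly one of the two index sets, it does so before and after the change, and the line with index
`d` provides the elementary operations that carry one matrix to the other
(`IsCornerTurn.of_mem_notMem`, `IsCornerTurn.of_notMem_mem`). Otherwise, `d` belongs to both index
sets for one letter and to none for the other; the additional entry `T d d = 1` is a pivot, and its
Schur complement is the other matrix up to signs (`IsCornerTurn.insert_insert`).
-/

/-! ### Stable equivalence of matrices indexed by finite types -/

namespace StablyEquivalent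

variable {S : Type*} [CommRing S]

theorem symm {m n m' n' : ℕ} {M : Matrix (Fin m) (Fin n) S} {N : Matrix (Fin m') (Fin n') S}
    (h : StablyEquivalent M N) : StablyEquivalent N M := by
  induction h with
  | refl M => exact .refl M
  | row M A hA =>
    obtain ⟨u, rfl⟩ := hA
    have := StablyEquivalent.row (u.val * M) u⁻¹.val u⁻¹.isUnit
    rwa [← Matrix.mul_assoc, Units.inv_mul, Matrix.one_mul] at this
  | col M A hA =>
    obtain ⟨u, rfl⟩ := hA
    have := StablyEquivalent.col (M * u.val) u⁻¹.val u⁻¹.isUnit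
    rwa [Matrix.mul_assoc, Units.mul_inv, Matrix.mul_one] at this
  | stabilize M => exact .destabilize M
  | destabilize M => exact .stabilize M
  | trans _ _ h1 h2 => exact h2.trans h1

theorem stabilize_transpose {m n : ℕ} (M : Matrix (Fin m) (Fin n) S) :
    M.stabilize.transpose = M.transpose.stabilize := by
  ext i j
  refine Fin.cases ?_ (fun i => ?_) i <;> refine Fin.cases ?_ (fun j => ?_) j <;>
    simp [Matrix.stabilize]

theorem transpose {m n m' n' : ℕ} {M : Matrix (Fin m) (Fin n) S} {N : Matrix (Fin m') (Fin n') S}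
    (h : StablyEquivalent M N) : StablyEquivalent M.transpose N.transpose := by
  induction h with
  | refl M => exact .refl _
  | row M A hA =>
    rw [Matrix.transpose_mul]
    exact .col _ _ ((Matrix.isUnit_transpose _).2 hA)
  | col M A hA =>
    rw [Matrix.transpose_mul]
    exact .row _ _ ((Matrix.isUnit_transpose _).2 hA)
  | stabilize M =>
    rw [stabilize_transpose]
    exact .stabilize _
  | destabilize M =>
    rw [stabilize_transpose]
    exact .destabilize _
  | trans _ _ h1 h2 => exact h1.trans h2

theorem submatrix {m n m' n' : ℕ} (M : Matrix (Fin m) (Fin n) S) (e : Fin m' ≃ Fin m)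
    (f : Fin n' ≃ Fin n) : StablyEquivalent M (M.submatrix e f) := by
  obtain rfl : m' = m := by simpa using Fintype.card_congr e
  obtain rfl : n' = n := by simpa using Fintype.card_congr f
  have key : ∀ {m n : ℕ} (M : Matrix (Fin m) (Fin n) S) (e : Equiv.Perm (Fin m)),
      StablyEquivalent M (M.submatrix e id) := by
    intro m n M e
    have h := StablyEquivalent.row M (e.toPEquiv.toMatrix : Matrix _ _ S) (by
      rw [Matrix.isUnit_iff_isUnit_det, Matrix.det_permutation]
      exact (Equiv.Perm.sign e).isUnit.map (Int.castRingHom S))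
    rwa [PEquiv.toMatrix_toPEquiv_mul] at h
  have h1 := key M e
  have h2 := (key (M.submatrix e id).transpose f).transpose
  exact h1.trans h2

end StablyEquivalent

/-- Stable equivalence of matrices whose rows and columns are indexed by arbitrary finite types:
the indices are enumerated, and the choice of the enumerations does not matter. -/
def StablyEquivalentIndexed {S : Type*} [CommRing S] {m n m' n' : Type*} [Fintype m] [Fintype n]
    [Fintype m'] [Fintype n'] (M : Matrix m n S) (N : Matrix m' n' S) : Prop :=
  StablyEquivalent (M.submatrix (Fintype.equivFin m).symm (Fintype.equivFin n).symm)
    (N.submatrix (Fintype.equivFin m').symm (Fintype.equivFin n').symm)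

namespace StablyEquivalentIndexed

variable {S : Type*} [CommRing S] {m n m' n' m'' n'' : Type*} [Fintype m] [Fintype n]
  [Fintype m'] [Fintype n'] [Fintype m''] [Fintype n'']

theorem symm {M : Matrix m n S} {N : Matrix m' n' S} (h : StablyEquivalentIndexed M N) :
    StablyEquivalentIndexed N M :=
  StablyEquivalent.symm h

theorem trans {M : Matrix m n S} {N : Matrix m' n' S} {K : Matrix m'' n'' S}
    (h : StablyEquivalentIndexed M N) (h' : StablyEquivalentIndexed N K) :
    StablyEquivalentIndexed M K :=
  StablyEquivalent.trans h h'

theorem transpose {M : Matrix m n S} {N : Matrix m' n' S} (h : StablyEquivalentIndexed M N) :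
    StablyEquivalentIndexed M.transpose N.transpose :=
  StablyEquivalent.transpose h

theorem submatrix (M : Matrix m n S) (e : m' ≃ m) (f : n' ≃ n) :
    StablyEquivalentIndexed M (M.submatrix e f) := by
  have h := StablyEquivalent.submatrix
    (M.submatrix (Fintype.equivFin m).symm (Fintype.equivFin n).symm)
    ((Fintype.equivFin m').symm.trans (e.trans (Fintype.equivFin m)))
    ((Fintype.equivFin n').symm.trans (f.trans (Fintype.equivFin n)))
  unfold StablyEquivalentIndexed
  convert h using 1
  ext i j
  simp

theorem stablyEquivalent {a b a' b' : ℕ} {M : Matrix (Fin a) (Fin b) S}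
    {N : Matrix (Fin a') (Fin b') S} (h : StablyEquivalentIndexed M N) : StablyEquivalent M N :=
  ((StablyEquivalent.submatrix M _ _).trans h).trans (StablyEquivalent.submatrix N _ _).symm

theorem row [DecidableEq m] (M : Matrix m n S) (A : Matrix m m S) (hA : IsUnit A) :
    StablyEquivalentIndexed M (A * M) := by
  have h := StablyEquivalent.row
    (M.submatrix (Fintype.equivFin m).symm (Fintype.equivFin n).symm)
    (A.submatrix (Fintype.equivFin m).symm (Fintype.equivFin m).symm)
    ((Matrix.isUnit_submatrix_equiv _ _).2 hA)
  rwa [Matrix.submatrix_mul_equiv] at h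

theorem col [DecidableEq n] (M : Matrix m n S) (A : Matrix n n S) (hA : IsUnit A) :
    StablyEquivalentIndexed M (M * A) := by
  have h := (row M.transpose A.transpose ((Matrix.isUnit_transpose _).2 hA)).transpose
  rwa [← Matrix.transpose_mul] at h

theorem of_stablyEquivalent {a b a' b' : ℕ} {M : Matrix (Fin a) (Fin b) S}
    {N : Matrix (Fin a') (Fin b') S} (h : StablyEquivalent M N) : StablyEquivalentIndexed M N :=
  ((StablyEquivalent.submatrix M _ _).symm.trans h).trans (StablyEquivalent.submatrix N _ _)

theorem bijective_elim_zero_succ {k : ℕ} {α : Type*} (e : α ≃ Fin k) : Function.Bijective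
    (Sum.elim (fun _ => 0) fun x => (e x).succ : Unit ⊕ α → Fin (k + 1)) := by
  constructor
  · rintro (x | x) (y | y) h
    · rfl
    · exact absurd h.symm (Fin.succ_ne_zero _)
    · exact absurd h (Fin.succ_ne_zero _)
    · simpa using h
  · refine fun y => Fin.cases ⟨Sum.inl (), rfl⟩ (fun y => ⟨Sum.inr (e.symm y), ?_⟩) y
    simp

theorem fromBlocks_one (M : Matrix m n S) :
    StablyEquivalentIndexed M (Matrix.fromBlocks (1 : Matrix Unit Unit S) 0 0 M) := by
  have h1 := submatrix M (Fintype.equivFin m).symm (Fintype.equivFin n).symm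
  have h2 := of_stablyEquivalent (StablyEquivalent.stabilize
    (M.submatrix (Fintype.equivFin m).symm (Fintype.equivFin n).symm))
  have h3 := submatrix (M.submatrix (Fintype.equivFin m).symm (Fintype.equivFin n).symm).stabilize
    (Equiv.ofBijective _ (bijective_elim_zero_succ (Fintype.equivFin m)))
    (Equiv.ofBijective _ (bijective_elim_zero_succ (Fintype.equivFin n)))
  convert (h1.trans h2).trans h3 using 1
  ext (i | i) (j | j) <;> simp [Matrix.stabilize]

/-- A pivot entry `1` can be removed by passing to its Schur complement. -/
theorem schurComplement (x : m → S) (y : n → S) (M : Matrix m n S) :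
    StablyEquivalentIndexed
      (Matrix.fromBlocks (1 : Matrix Unit Unit S) (Matrix.of fun _ j => y j)
        (Matrix.of fun i _ => x i) M)
      (Matrix.of fun i j => M i j - x i * y j) := by
  classical
  let _ : Invertible (1 : Matrix Unit Unit S) := invertibleOne
  rw [Matrix.fromBlocks_eq_of_invertible₁₁, invOf_one, Matrix.mul_one, Matrix.one_mul]
  have e : M - (Matrix.of fun i _ => x i : Matrix m Unit S) *
      (Matrix.of fun _ j => y j : Matrix Unit n S) = Matrix.of fun i j => M i j - x i * y j := by
    ext i j
    simp [Matrix.mul_apply]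
  rw [e]
  exact (((fromBlocks_one _).trans (row _ _ (Matrix.isUnit_fromBlocks_zero₁₂.2
    ⟨isUnit_one, isUnit_one⟩))).trans (col _ _ (Matrix.isUnit_fromBlocks_zero₂₁.2
    ⟨isUnit_one, isUnit_one⟩))).symm

theorem row_scale (M : Matrix m n S) (u : m → Sˣ) :
    StablyEquivalentIndexed M (Matrix.of fun i j => u i * M i j) := by
  classical
  have h := row M (Matrix.diagonal fun i => (u i : S))
    (Matrix.isUnit_diagonal.2 (Pi.isUnit_iff.2 fun i => (u i).isUnit))
  convert h using 1
  ext i j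
  simp

theorem col_scale (M : Matrix m n S) (u : n → Sˣ) :
    StablyEquivalentIndexed M (Matrix.of fun i j => u j * M i j) :=
  (row_scale M.transpose u).transpose

/-- Multiples of one row may be added to the other rows, after a scaling of the rows by units. -/
theorem row_operation (M : Matrix m n S) (i₀ : m) (x : m → S) (hx : x i₀ = 0) (u : m → Sˣ)
    (hu : u i₀ = 1) :
    StablyEquivalentIndexed M (Matrix.of fun i j => u i * M i j + x i * M i₀ j) := by
  classical
  have hN : IsNilpotent (Matrix.vecMulVec x (Pi.single i₀ (1 : S))) := by
    refine ⟨2, ?_⟩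
    rw [pow_two, Matrix.vecMulVec_mul_vecMulVec]
    simp [hx]
  refine (row_scale M u).trans ?_
  have h := row (Matrix.of fun i j => u i * M i j) (1 + Matrix.vecMulVec x (Pi.single i₀ (1 : S)))
    hN.isUnit_one_add
  convert h using 1
  ext i j
  rw [Matrix.add_mul, Matrix.one_mul, Matrix.add_apply]
  simp [Matrix.mul_apply, Matrix.vecMulVec_apply, Pi.single_apply, hu]

theorem col_operation (M : Matrix m n S) (j₀ : n) (y : n → S) (hy : y j₀ = 0) (u : n → Sˣ)
    (hu : u j₀ = 1) :
    StablyEquivalentIndexed M (Matrix.of fun i j => u j * M i j + y j * M i j₀) :=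
  (row_operation M.transpose j₀ y hy u hu).transpose

end StablyEquivalentIndexed

/-! ### Generating functions of fillings -/

/-- The weight of a filling `T`, that is, the exponent `α` of its monomial `x ^ T`: the number `k`
occurs `α k` times in `T`. -/
noncomputable def fillingWeight {ι : Type*} [Fintype ι] (T : ι → ℕ) : ℕ →₀ ℕ :=
  ∑ s, Finsupp.single (T s) 1

/-- The sum of the monomials `x ^ T` of all fillings `T` that satisfy the condition `C`. -/
noncomputable def fillingSeries (R : Type*) [CommRing R] {ι : Type*} [Fintype ι]
    (C : (ι → ℕ) → Prop) : MvPowerSeries ℕ R :=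
  fun α => ((Nat.card {T : ι → ℕ // C T ∧ fillingWeight T = α} : ℕ) : R)

section fillings

variable {R : Type*} [CommRing R] {ι κ : Type*} [Fintype ι] [Fintype κ]

theorem fillingWeight_apply (T : ι → ℕ) (k : ℕ) :
    fillingWeight T k = (Finset.univ.filter fun s => T s = k).card := by
  rw [fillingWeight, Finsupp.finsetSum_apply, Finset.card_filter]
  simp only [Finsupp.single_apply]

theorem fillingWeight_degree (T : ι → ℕ) : (fillingWeight T).degree = Fintype.card ι := by
  simp [fillingWeight, map_sum]

theorem fillingWeight_comp (T : ι → ℕ) (e : κ ≃ ι) :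
    fillingWeight (T ∘ e) = fillingWeight T :=
  Equiv.sum_comp e fun s => Finsupp.single (T s) 1

theorem finite_fillingWeight_eq (C : (ι → ℕ) → Prop) (α : ℕ →₀ ℕ) :
    Finite {T : ι → ℕ // C T ∧ fillingWeight T = α} := by
  refine ((Set.Finite.pi' fun _ : ι => α.support.finite_toSet).subset ?_).to_subtype
  rintro T ⟨-, rfl⟩ s
  rw [Finset.mem_coe, Finsupp.mem_support_iff, fillingWeight_apply, Finset.card_ne_zero]
  exact ⟨s, by simp⟩

theorem coeff_fillingSeries (C : (ι → ℕ) → Prop) (α : ℕ →₀ ℕ) :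
    MvPowerSeries.coeff α (fillingSeries R C) =
      ((Nat.card {T : ι → ℕ // C T ∧ fillingWeight T = α} : ℕ) : R) := rfl

theorem coeff_fillingSeries_eq_zero (C : (ι → ℕ) → Prop) {α : ℕ →₀ ℕ}
    (hα : α.degree ≠ Fintype.card ι) : MvPowerSeries.coeff α (fillingSeries R C) = 0 := by
  have : IsEmpty {T : ι → ℕ // C T ∧ fillingWeight T = α} :=
    ⟨fun T => hα (by rw [← T.2.2, fillingWeight_degree])⟩
  rw [coeff_fillingSeries, Nat.card_of_isEmpty, Nat.cast_zero]

/-- Fillings may be transported along a bijection of the boxes. -/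
theorem fillingSeries_congr {C : (ι → ℕ) → Prop} {C' : (κ → ℕ) → Prop} (e : κ ≃ ι)
    (h : ∀ T : ι → ℕ, C T ↔ C' (T ∘ e)) : fillingSeries R C = fillingSeries R C' := by
  ext α
  rw [coeff_fillingSeries, coeff_fillingSeries]
  congr 1
  refine Nat.card_congr ((e.arrowCongr (Equiv.refl ℕ)).symm.subtypeEquiv fun T => ?_)
  have : (e.arrowCongr (Equiv.refl ℕ)).symm T = T ∘ e := by ext; simp
  rw [this, fillingWeight_comp, h]

theorem fillingSeries_of_isEmpty [IsEmpty ι] {C : (ι → ℕ) → Prop} (h : ∀ T, C T) :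
    fillingSeries R C = 1 := by
  classical
  ext α
  rw [MvPowerSeries.coeff_one]
  split_ifs with hα
  · subst hα
    have : Unique {T : ι → ℕ // C T ∧ fillingWeight T = 0} :=
      { default := ⟨isEmptyElim, h _, by simp [fillingWeight]⟩
        uniq := fun T => Subtype.ext (Subsingleton.elim _ _) }
    rw [coeff_fillingSeries, Nat.card_unique, Nat.cast_one]
  · refine coeff_fillingSeries_eq_zero C ?_
    rwa [Fintype.card_of_isEmpty, Ne, Finsupp.degree_eq_zero_iff]

/-- Fillings are classified by an additional condition. -/
theorem fillingSeries_and_add_and_not (C E : (ι → ℕ) → Prop) :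
    fillingSeries R (fun T => C T ∧ E T) + fillingSeries R (fun T => C T ∧ ¬ E T) =
      fillingSeries R C := by
  classical
  ext α
  rw [map_add, coeff_fillingSeries, coeff_fillingSeries, coeff_fillingSeries, ← Nat.cast_add]
  congr 1
  have := finite_fillingWeight_eq C α
  have := finite_fillingWeight_eq (fun T => C T ∧ E T) α
  have := finite_fillingWeight_eq (fun T => C T ∧ ¬ E T) α
  rw [← Nat.card_sum]
  refine Nat.card_congr (Equiv.trans (Equiv.sumCongr ?_ ?_) (Equiv.sumCompl
    (fun T : {T : ι → ℕ // C T ∧ fillingWeight T = α} => E T.1)))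
  · exact (Equiv.subtypeEquivRight fun T => by tauto).trans
      (Equiv.subtypeSubtypeEquivSubtypeInter _ _).symm
  · exact (Equiv.subtypeEquivRight fun T => by tauto).trans
      (Equiv.subtypeSubtypeEquivSubtypeInter _ (fun T => ¬ E T)).symm

/-- A pair of fillings of two shapes is a filling of their disjoint union. -/
theorem fillingSeries_mul (C : (ι → ℕ) → Prop) (C' : (κ → ℕ) → Prop) :
    fillingSeries R C * fillingSeries R C' =
      fillingSeries R fun T : ι ⊕ κ → ℕ => C (T ∘ Sum.inl) ∧ C' (T ∘ Sum.inr) := by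
  classical
  ext α
  have := fun α => finite_fillingWeight_eq C α
  have := fun α => finite_fillingWeight_eq C' α
  simp only [MvPowerSeries.coeff_mul, coeff_fillingSeries, ← Nat.cast_mul, ← Nat.card_prod]
  rw [← Nat.cast_sum, ← Finset.sum_coe_sort, ← Nat.card_sigma]
  congr 1
  have hw : ∀ T : ι ⊕ κ → ℕ,
      fillingWeight T = fillingWeight (T ∘ Sum.inl) + fillingWeight (T ∘ Sum.inr) := fun T =>
    Fintype.sum_sum_type _
  refine Nat.card_congr
    { toFun := fun T => ⟨Sum.elim T.2.1.1 T.2.2.1, ⟨T.2.1.2.1, T.2.2.2.1⟩, ?_⟩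
      invFun := fun T => ⟨⟨(fillingWeight (T.1 ∘ Sum.inl), fillingWeight (T.1 ∘ Sum.inr)), ?_⟩,
        ⟨T.1 ∘ Sum.inl, T.2.1.1, rfl⟩, ⟨T.1 ∘ Sum.inr, T.2.1.2, rfl⟩⟩
      left_inv := ?_
      right_inv := ?_ }
  · rw [hw]
    have := T.1.2
    rw [Finset.HasAntidiagonal.mem_antidiagonal] at this
    exact (congrArg₂ (· + ·) T.2.1.2.2 T.2.2.2.2).trans this
  · rw [Finset.HasAntidiagonal.mem_antidiagonal, ← hw, T.2.2]
  · rintro ⟨⟨⟨β, γ⟩, h⟩, ⟨T, hT, hβ⟩, ⟨T', hT', hγ⟩⟩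
    dsimp only at hβ hγ
    subst hβ hγ
    rfl
  · rintro ⟨T, h⟩
    simp

/-- The weakly increasing sequence with given entries is unique, and sorting provides it. -/
theorem card_monotone_fillingWeight {n : ℕ} {α : ℕ →₀ ℕ} (hα : α.degree = n) :
    Nat.card {T : Fin n → ℕ // Monotone T ∧ fillingWeight T = α} = 1 := by
  classical
  have hw : ∀ T : Fin n → ℕ, Finsupp.toMultiset (fillingWeight T) = List.ofFn T := by
    intro T
    rw [← Fin.univ_val_map, ← Multiset.sum_map_singleton (Finset.univ.val.map T),
      Multiset.map_map, fillingWeight, map_sum]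
    simp only [Finsupp.toMultiset_single, one_smul]
    rfl
  rw [Nat.card_eq_one_iff_unique]
  constructor
  · constructor
    rintro ⟨T, hT, h⟩ ⟨T', hT', h'⟩
    have := hw T
    rw [h, ← h', hw] at this
    exact Subtype.ext (List.ofFn_injective
      ((Multiset.coe_eq_coe.1 this.symm).eq_of_sortedLE hT.sortedLE_ofFn hT'.sortedLE_ofFn))
  · have hc : Multiset.card (Finsupp.toMultiset α) = n := by
      rw [Finsupp.card_toMultiset, ← hα]; rfl
    obtain ⟨l, hl⟩ : ∃ l : List ℕ, (l : Multiset ℕ) = Finsupp.toMultiset α :=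
      ⟨_, Multiset.coe_toList _⟩
    have hln : l.length = n := by rw [← hc, ← hl]; rfl
    subst hln
    refine ⟨⟨l.get ∘ Tuple.sort l.get, Tuple.monotone_sort _, ?_⟩⟩
    rw [fillingWeight_comp]
    apply Finsupp.orderIsoMultiset.injective
    rw [Finsupp.coe_orderIsoMultiset]
    rw [hw, ← hl, List.ofFn_get]

/-- A power series whose coefficients depend only on the degree of the monomial is symmetric. -/
theorem renameEquiv_eq_self {f : MvPowerSeries ℕ R}
    (hf : ∀ α β : ℕ →₀ ℕ, α.degree = β.degree →
      MvPowerSeries.coeff α f = MvPowerSeries.coeff β f) (σ : Equiv.Perm ℕ) :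
    MvPowerSeries.renameEquiv R σ f = f := by
  ext α
  obtain ⟨β, rfl⟩ : ∃ β, α = Finsupp.embDomain σ.toEmbedding β :=
    ⟨Finsupp.mapDomain σ.symm α, by
      rw [Finsupp.embDomain_eq_mapDomain]
      simp [← Finsupp.mapDomain_comp]⟩
  refine (MvPowerSeries.coeff_embDomain_rename σ.toEmbedding f β).trans (hf _ _ ?_)
  rw [Finsupp.embDomain_eq_mapDomain, Finsupp.degree_mapDomain]

end fillings

/-! ### Ribbon Schur functions -/

/-- The conditions on a semistandard filling of a ribbon. The boxes of the ribbon are given by their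
contents `c`, `p ≤ c < q`, and the ribbon goes up from the box of content `c` if `c ∈ w` and to the
right otherwise. -/
def IsRibbonFilling (w : Finset ℤ) (p q : ℤ) (t : Finset.Ico p q → ℕ) : Prop :=
  ∀ c d : Finset.Ico p q, d.1 = c.1 + 1 → if c.1 ∈ w then t d < t c else t c ≤ t d

/-- The ribbon Schur function of the ribbon with contents `p, …, q - 1` that goes up from the boxes
whose content is in `w`. It is `1` if `p = q`, and `0` if `q < p`. -/
noncomputable def ribbonSchur (R : Type*) [CommRing R] (w : Finset ℤ) (p q : ℤ) :
    MvPowerSeries ℕ R :=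
  if p ≤ q then fillingSeries R (IsRibbonFilling w p q) else 0

section ribbons

variable {R : Type*} [CommRing R] {w : Finset ℤ} {c p q : ℤ}

theorem ribbonSchur_of_lt (h : q < p) : ribbonSchur R w p q = 0 :=
  if_neg h.not_ge

theorem ribbonSchur_self : ribbonSchur R w p p = 1 := by
  rw [ribbonSchur, if_pos le_rfl]
  have : IsEmpty (Finset.Ico p p) := ⟨fun a => by simpa using a.2⟩
  exact fillingSeries_of_isEmpty fun T => isEmptyElim

theorem ribbonSchur_insert_of_le (h : c + 1 ≤ p ∨ q ≤ c + 1) :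
    ribbonSchur R (insert c w) p q = ribbonSchur R w p q := by
  unfold ribbonSchur
  congr 2
  funext t
  refine propext (forall₃_congr fun a b hab => ?_)
  have ha := Finset.mem_Ico.1 a.2
  have hb := Finset.mem_Ico.1 b.2
  have : a.1 ∈ insert c w ↔ a.1 ∈ w := by
    rw [Finset.mem_insert, or_iff_right (by omega)]
  simp only [this]

/-- A filling of a ribbon which is cut between the contents `c` and `c + 1` is a filling of one of
the two ribbons into which the two pieces can be glued. -/
theorem ribbonSchur_mul (hc : c ∉ w) (hp : p < c + 1) (hq : c + 1 < q) :
    ribbonSchur R w p (c + 1) * ribbonSchur R w (c + 1) q =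
      ribbonSchur R w p q + ribbonSchur R (insert c w) p q := by
  let C : (Finset.Ico p q → ℕ) → Prop := fun t =>
    ∀ a b : Finset.Ico p q, b.1 = a.1 + 1 → a.1 ≠ c → if a.1 ∈ w then t b < t a else t a ≤ t b
  let x : Finset.Ico p q := ⟨c, Finset.mem_Ico.2 ⟨by omega, by omega⟩⟩
  let y : Finset.Ico p q := ⟨c + 1, Finset.mem_Ico.2 ⟨by omega, by omega⟩⟩
  have h1 : IsRibbonFilling w p q = fun t => C t ∧ t x ≤ t y := by
    funext t
    refine propext ⟨fun h => ⟨fun a b hab _ => h a b hab, ?_⟩, fun h a b hab => ?_⟩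
    · have := h x y rfl
      rwa [if_neg hc] at this
    · by_cases hac : a.1 = c
      · obtain rfl : a = x := Subtype.ext hac
        obtain rfl : b = y := Subtype.ext hab
        rw [if_neg hc]
        exact h.2
      · exact h.1 a b hab hac
  have h2 : IsRibbonFilling (insert c w) p q = fun t => C t ∧ ¬ t x ≤ t y := by
    funext t
    have hins : ∀ a : Finset.Ico p q, a.1 ≠ c → (a.1 ∈ insert c w ↔ a.1 ∈ w) := fun a ha => by
      rw [Finset.mem_insert, or_iff_right ha]
    refine propext ⟨fun h => ⟨fun a b hab hac => ?_, ?_⟩, fun h a b hab => ?_⟩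
    · have := h a b hab
      simpa only [hins a hac] using this
    · have := h x y rfl
      rw [if_pos (Finset.mem_insert_self _ _)] at this
      exact this.not_ge
    · by_cases hac : a.1 = c
      · obtain rfl : a = x := Subtype.ext hac
        obtain rfl : b = y := Subtype.ext hab
        rw [if_pos (Finset.mem_insert_self _ _)]
        exact not_le.1 h.2
      · simpa only [hins a hac] using h.1 a b hab hac
  rw [ribbonSchur, ribbonSchur, ribbonSchur, ribbonSchur, if_pos hp.le, if_pos hq.le,
    if_pos (by omega), if_pos (by omega), h1, h2, fillingSeries_and_add_and_not, fillingSeries_mul]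
  have hl : ∀ a : Finset.Ico p (c + 1), a.1 ∈ Finset.Ico p q := fun a => by
    have := Finset.mem_Ico.1 a.2
    exact Finset.mem_Ico.2 ⟨by omega, by omega⟩
  have hr : ∀ a : Finset.Ico (c + 1) q, a.1 ∈ Finset.Ico p q := fun a => by
    have := Finset.mem_Ico.1 a.2
    exact Finset.mem_Ico.2 ⟨by omega, by omega⟩
  let e : Finset.Ico p (c + 1) ⊕ Finset.Ico (c + 1) q → Finset.Ico p q :=
    Sum.elim (fun a => ⟨a.1, hl a⟩) fun a => ⟨a.1, hr a⟩
  have he : Function.Bijective e := by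
    constructor
    · rintro (a | a) (b | b) hab
      all_goals
        have ha := Finset.mem_Ico.1 a.2
        have hb := Finset.mem_Ico.1 b.2
        have hab := congrArg Subtype.val hab
        simp only [e, Sum.elim_inl, Sum.elim_inr] at hab
      · exact congrArg _ (Subtype.ext hab)
      · omega
      · omega
      · exact congrArg _ (Subtype.ext hab)
    · intro a
      have ha := Finset.mem_Ico.1 a.2
      by_cases hac : a.1 < c + 1
      · exact ⟨Sum.inl ⟨a.1, Finset.mem_Ico.2 ⟨ha.1, hac⟩⟩, rfl⟩
      · exact ⟨Sum.inr ⟨a.1, Finset.mem_Ico.2 ⟨by omega, ha.2⟩⟩, rfl⟩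
  refine (fillingSeries_congr (Equiv.ofBijective e he) fun t => ?_).symm
  constructor
  · intro h
    refine ⟨fun a b hab => ?_, fun a b hab => ?_⟩
    · have ha := Finset.mem_Ico.1 a.2
      have hb := Finset.mem_Ico.1 b.2
      exact h ⟨a.1, hl a⟩ ⟨b.1, hl b⟩ hab (by simp only; omega)
    · have ha := Finset.mem_Ico.1 a.2
      exact h ⟨a.1, hr a⟩ ⟨b.1, hr b⟩ hab (by simp only; omega)
  · rintro ⟨h, h'⟩ a b hab hac
    have ha := Finset.mem_Ico.1 a.2
    have hb := Finset.mem_Ico.1 b.2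
    by_cases hlt : a.1 < c
    · exact h ⟨a.1, Finset.mem_Ico.2 ⟨ha.1, by omega⟩⟩ ⟨b.1, Finset.mem_Ico.2 ⟨hb.1, by omega⟩⟩ hab
    · exact h' ⟨a.1, Finset.mem_Ico.2 ⟨by omega, ha.2⟩⟩ ⟨b.1, Finset.mem_Ico.2 ⟨by omega, hb.2⟩⟩ hab

/-- If the ribbon is a row, its Schur function is a complete homogeneous symmetric function. -/
theorem coeff_ribbonSchur_empty {n : ℕ} {α : ℕ →₀ ℕ} (hq : q = p + n) (hα : α.degree = n) :
    MvPowerSeries.coeff α (ribbonSchur R ∅ p q) = 1 := by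
  have hmono : ∀ t : Finset.Ico p q → ℕ, IsRibbonFilling ∅ p q t ↔ Monotone t := by
    intro t
    constructor
    · intro h
      have key : ∀ (k : ℕ) (a b : Finset.Ico p q), b.1 = a.1 + k → t a ≤ t b := by
        intro k
        induction k with
        | zero =>
          intro a b hab
          obtain rfl : a = b := Subtype.ext (by simpa using hab.symm)
          rfl
        | succ k ih =>
          intro a b hab
          have ha := Finset.mem_Ico.1 a.2
          have hb := Finset.mem_Ico.1 b.2
          push_cast at hab
          have h1 := ih a ⟨a.1 + k, Finset.mem_Ico.2 ⟨by omega, by omega⟩⟩ rfl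
          have h2 := h ⟨a.1 + k, Finset.mem_Ico.2 ⟨by omega, by omega⟩⟩ b (by simp only; omega)
          rw [if_neg (Finset.notMem_empty _)] at h2
          exact h1.trans h2
      intro a b hab
      obtain ⟨k, hk⟩ := Int.le.dest (Subtype.coe_le_coe.2 hab)
      exact key k a b hk.symm
    · intro h a b hab
      rw [if_neg (Finset.notMem_empty _)]
      exact h (Subtype.coe_le_coe.1 (by omega))
  have hmem : ∀ i : Fin n, p + (i : ℕ) ∈ Finset.Ico p q := fun i =>
    Finset.mem_Ico.2 ⟨by omega, by omega⟩
  let f : Fin n → Finset.Ico p q := fun i => ⟨p + (i : ℕ), hmem i⟩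
  have hf : StrictMono f := fun i j hij => Subtype.coe_lt_coe.1 (by simp only [f]; omega)
  have hs : Function.Surjective f := fun a => by
    have ha := Finset.mem_Ico.1 a.2
    exact ⟨⟨(a.1 - p).toNat, by omega⟩, Subtype.ext (by simp only [f]; omega)⟩
  rw [ribbonSchur, if_pos (by omega),
    fillingSeries_congr (C' := Monotone) (hf.orderIsoOfSurjective f hs).toEquiv, coeff_fillingSeries,
    card_monotone_fillingWeight hα, Nat.cast_one]
  intro t
  rw [hmono]
  refine ⟨fun h => h.comp (hf.orderIsoOfSurjective f hs).monotone, fun h => ?_⟩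
  have := h.comp (hf.orderIsoOfSurjective f hs).symm.monotone
  convert this
  ext a
  exact congrArg t ((hf.orderIsoOfSurjective f hs).apply_symm_apply a).symm

theorem coeff_ribbonSchur_eq_zero {α : ℕ →₀ ℕ} (hα : (α.degree : ℤ) ≠ q - p) :
    MvPowerSeries.coeff α (ribbonSchur R w p q) = 0 := by
  rw [ribbonSchur]
  split_ifs with h
  · refine coeff_fillingSeries_eq_zero _ fun hd => hα ?_
    rw [hd, Fintype.card_coe, Int.card_Ico]
    omega
  · exact map_zero _

/-- Ribbon Schur functions are symmetric: turning one corner of the ribbon reduces this to ribbons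
with fewer steps upwards, and finally to complete homogeneous symmetric functions. -/
theorem ribbonSchur_mem (w : Finset ℤ) (p q : ℤ) : ribbonSchur R w p q ∈ symmFunctions R := by
  induction w using Finset.induction_on generalizing p q with
  | empty =>
    refine ⟨renameEquiv_eq_self fun α β hαβ => ?_, (q - p).toNat, fun α hα => ?_⟩
    · by_cases h : (α.degree : ℤ) = q - p
      · rw [coeff_ribbonSchur_empty (n := α.degree) (by omega) rfl,
          coeff_ribbonSchur_empty (n := α.degree) (by omega) hαβ.symm]
      · rw [coeff_ribbonSchur_eq_zero h, coeff_ribbonSchur_eq_zero (by rwa [← hαβ])]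
    · exact coeff_ribbonSchur_eq_zero (by omega)
  | insert c w hc ih =>
    by_cases h : c + 1 ≤ p ∨ q ≤ c + 1
    · rw [ribbonSchur_insert_of_le h]
      exact ih p q
    · push Not at h
      rw [eq_sub_of_add_eq' (ribbonSchur_mul (R := R) hc h.1 h.2).symm]
      exact sub_mem (mul_mem (ih _ _) (ih _ _)) (ih _ _)

end ribbons

/-! ### Turning a corner of the cutting strip -/

/-- The effect on the upper unitriangular array of the ribbon Schur functions `T p q` (contents
`p, …, q - 1`) of turning the corner of the ribbon between the contents `d - 1` and `d`. -/
structure IsCornerTurn {S : Type*} [CommRing S] (d : ℤ) (T T' : ℤ → ℤ → S) : Prop where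
  eq_zero : ∀ p q, q < p → T p q = 0
  self : T d d = 1
  eq_of_le : ∀ p q, d ≤ p ∨ q ≤ d → T' p q = T p q
  turn : ∀ p q, p < d → d < q → T' p q = T p d * T d q - T p q

/-- The submatrix of the transpose of the array `T` with rows in `J` and columns in `I`. -/
def arraySubmatrix {S : Type*} (T : ℤ → ℤ → S) (J I : Finset ℤ) : Matrix J I S :=
  Matrix.of fun q p => T p q

namespace IsCornerTurn

variable {S : Type*} [CommRing S] {d : ℤ} {T T' : ℤ → ℤ → S}

theorem symm (h : IsCornerTurn d T T') : IsCornerTurn d T' T where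
  eq_zero p q hqp := by
    rw [h.eq_of_le p q (by omega), h.eq_zero p q hqp]
  self := by rw [h.eq_of_le d d (by omega), h.self]
  eq_of_le p q hpq := (h.eq_of_le p q hpq).symm
  turn p q hp hq := by
    rw [h.turn p q hp hq, h.eq_of_le p d (by omega), h.eq_of_le d q (by omega), sub_sub_cancel]

/-- Corner turns change the sign of the block of the array above and to the right of `(d, d)`, up to
a correction. The sign change amounts to multiplying both rows and columns by these signs. -/
theorem eq_sign_mul (h : IsCornerTurn d T T') {p q : ℤ} (hp : p ≠ d) (hq : q ≠ d) :
    T' p q = (if q < d then -1 else 1 : Sˣ) * ((if p < d then -1 else 1 : Sˣ) * T p q) +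
      (if p < d ∧ d < q then 1 else 0) * (T p d * T d q) := by
  rcases lt_or_gt_of_ne hp with hp | hp <;> rcases lt_or_gt_of_ne hq with hq | hq
  · rw [h.eq_of_le p q (by omega), if_pos hp, if_pos hq, if_neg (by omega)]
    simp
  · rw [h.turn p q hp hq, if_pos hp, if_neg hq.not_gt, if_pos ⟨hp, hq⟩]
    simp
    ring
  · rw [h.eq_of_le p q (by omega), h.eq_zero p q (by omega)]
    simp [hp.not_gt]
  · rw [h.eq_of_le p q (by omega), if_neg hp.not_gt, if_neg hq.not_gt, if_neg (by omega)]
    simp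

/-- If neither the row nor the column of the corner is present, then the corner turn introduces a
pivot entry, and passing to its Schur complement undoes this. -/
theorem insert_insert (h : IsCornerTurn d T T') {I J : Finset ℤ} (hI : d ∉ I) (hJ : d ∉ J) :
    StablyEquivalentIndexed (arraySubmatrix T J I)
      (arraySubmatrix T' (insert d J) (insert d I)) := by
  let E : ∀ (K : Finset ℤ), d ∉ K → (Unit ⊕ K ≃ (insert d K : Finset ℤ)) := fun K hK =>
    Equiv.ofBijective (Sum.elim (fun _ => ⟨d, Finset.mem_insert_self d K⟩)
      fun x => ⟨x.1, Finset.mem_insert_of_mem x.2⟩) (by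
        constructor
        · rintro (x | x) (y | y) hxy
          · rfl
          · exact absurd (congrArg Subtype.val hxy) fun e : d = y.1 => hK (e ▸ y.2)
          · exact absurd (congrArg Subtype.val hxy) fun e : x.1 = d => hK (e ▸ x.2)
          · exact congrArg _ (Subtype.ext (congrArg Subtype.val hxy :))
        · rintro ⟨x, hx⟩
          rcases Finset.mem_insert.1 hx with rfl | hx
          · exact ⟨Sum.inl (), rfl⟩
          · exact ⟨Sum.inr ⟨x, hx⟩, rfl⟩)
  have h1 := (StablyEquivalentIndexed.row_scale
    (arraySubmatrix T J I) fun q => if q.1 < d then -1 else 1).trans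
    (StablyEquivalentIndexed.col_scale _ fun p => if p.1 < d then -1 else 1)
  have h2 := StablyEquivalentIndexed.schurComplement (fun q : J => T' d q) (fun p : I => T' p d)
    (arraySubmatrix T' J I)
  have h3 := StablyEquivalentIndexed.submatrix
    (arraySubmatrix T' (insert d J) (insert d I))
    (E J hJ) (E I hI)
  have e1 : (arraySubmatrix T' (insert d J) (insert d I)).submatrix (E J hJ) (E I hI) =
      Matrix.fromBlocks (1 : Matrix Unit Unit S)
        (Matrix.of fun _ (p : I) => T' p d) (Matrix.of fun (q : J) _ => T' d q)
        (arraySubmatrix T' J I) := by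
    ext (q | q) (p | p)
    · change T' d d = (1 : Matrix Unit Unit S) q p
      rw [Subsingleton.elim q p, Matrix.one_apply_eq, h.symm.self]
    all_goals rfl
  rw [e1] at h3
  refine (h1.trans ?_).trans (h3.trans h2).symm
  have e2 : ∀ (q : J) (p : I), T' p q - T' d q * T' p d =
      (if p.1 < d then -1 else 1 : Sˣ) * ((if q.1 < d then -1 else 1 : Sˣ) * T p q) := by
    intro q p
    have hp : p.1 ≠ d := fun e => hI (e ▸ p.2)
    have hq : q.1 ≠ d := fun e => hJ (e ▸ q.2)
    rw [h.eq_sign_mul hp hq, h.eq_of_le d q (by omega), h.eq_of_le p d (by omega)]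
    by_cases hpq : p.1 < d ∧ d < q.1
    · rw [if_pos hpq]; ring
    · rw [if_neg hpq]
      have : T p d * T d q = 0 := by
        rcases lt_or_gt_of_ne hp with hp | hp
        · rw [h.eq_zero d q (by omega), mul_zero]
        · rw [h.eq_zero p d (by omega), zero_mul]
      linear_combination -this
  have e3 : (Matrix.of fun (q : J) (p : I) => arraySubmatrix T' J I q p -
      T' d q * T' p d) = Matrix.of fun (q : J) (p : I) =>
        ((if p.1 < d then -1 else 1 : Sˣ) : S) *
          (((if q.1 < d then -1 else 1 : Sˣ) : S) * T p q) := by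
    ext q p
    exact e2 q p
  rw [e3]
  exact .refl _

/-- If only the column of the corner is present, then the corner turn consists of elementary column
operations with this column, up to signs. -/
theorem of_mem_notMem (h : IsCornerTurn d T T') {I J : Finset ℤ} (hI : d ∈ I) (hJ : d ∉ J) :
    StablyEquivalentIndexed (arraySubmatrix T J I)
      (arraySubmatrix T' J I) := by
  have h1 := (StablyEquivalentIndexed.row_scale
    (arraySubmatrix T J I) fun q => if q.1 < d then -1 else 1).trans
    (StablyEquivalentIndexed.col_operation _ ⟨d, hI⟩ (fun p : I => if p.1 < d then T p d else 0)
      (if_neg (lt_irrefl d)) (fun p => if p.1 < d then -1 else 1) (if_neg (lt_irrefl d)))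
  convert h1 using 1
  ext q p
  have hq : q.1 ≠ d := fun e => hJ (e ▸ q.2)
  simp only [arraySubmatrix, Matrix.of_apply]
  by_cases hp : p.1 = d
  · rw [hp, h.eq_of_le d q (by omega)]
    rcases lt_or_gt_of_ne hq with hq | hq
    · simp [h.eq_zero d q hq]
    · simp [hq.not_gt]
  · rw [h.eq_sign_mul hp hq]
    rcases lt_or_gt_of_ne hq with hq | hq
    · rw [h.eq_zero d q hq]
      split_ifs <;> simp
    · by_cases hp : p.1 < d <;> simp [hp, hq, hq.not_gt]

/-- If only the row of the corner is present, then the corner turn consists of elementary row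
operations with this row, up to signs. -/
theorem of_notMem_mem (h : IsCornerTurn d T T') {I J : Finset ℤ} (hI : d ∉ I) (hJ : d ∈ J) :
    StablyEquivalentIndexed (arraySubmatrix T J I)
      (arraySubmatrix T' J I) := by
  -- These signs are the opposite of those in `of_mem_notMem`: the row `d` itself must not change, and
  -- its entries `T p d` vanish for `p > d`.
  have h1 := (StablyEquivalentIndexed.col_scale
    (arraySubmatrix T J I) fun p => if p.1 < d then 1 else -1).trans
    (StablyEquivalentIndexed.row_operation _ ⟨d, hJ⟩ (fun q : J => if d < q.1 then T d q else 0)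
      (if_neg (lt_irrefl d)) (fun q => if q.1 ≤ d then 1 else -1) (if_pos le_rfl))
  convert h1 using 1
  ext q p
  have hp : p.1 ≠ d := fun e => hI (e ▸ p.2)
  simp only [arraySubmatrix, Matrix.of_apply]
  rcases lt_or_gt_of_ne hp with hp | hp
  · rcases le_or_gt q.1 d with hq | hq
    · simp [h.eq_of_le p q (Or.inr hq), hp, hq, hq.not_gt]
    · simp [h.turn p q hp hq, hp, hq, hq.not_ge]
      ring
  · rw [h.eq_of_le p q (Or.inl hp.le), h.eq_zero p d hp]
    rcases le_or_gt q.1 d with hq | hq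
    · simp [h.eq_zero p q (hq.trans_lt hp)]
    · simp [hp.not_gt, hq.not_ge]

end IsCornerTurn

/-- Adding `c` to a word turns the corner between `c` and `c + 1`. -/
theorem isCornerTurn_ribbonSchur {R : Type*} [CommRing R] {w : Finset ℤ} {c : ℤ} (hc : c ∉ w) :
    IsCornerTurn (c + 1)
      (fun p q => (⟨ribbonSchur R w p q, ribbonSchur_mem w p q⟩ : symmFunctions R))
      (fun p q => ⟨ribbonSchur R (insert c w) p q, ribbonSchur_mem (insert c w) p q⟩) where
  eq_zero _ _ h := Subtype.ext (ribbonSchur_of_lt h)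
  self := Subtype.ext ribbonSchur_self
  eq_of_le _ _ h := Subtype.ext (ribbonSchur_insert_of_le h)
  turn _ _ hp hq := Subtype.ext (eq_sub_of_add_eq' (ribbonSchur_mul hc hp hq).symm)

/-! ### Initial and terminal boxes of a skew diagram with prescribed directions -/

/-- The box `b` is initial for the word `w`: the box from which the word leads to `b`, the one below
`b` or the one to the left of `b`, is not in `D`. -/
def IsInitialBox (D : Finset (ℕ × ℕ)) (w : Finset ℤ) (b : ℕ × ℕ) : Prop :=
  b ∈ D ∧ (content b - 1 ∈ w → (b.1 + 1, b.2) ∉ D) ∧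
    (content b - 1 ∉ w → ∀ j : ℕ, j + 1 = b.2 → (b.1, j) ∉ D)

/-- The box `b` is terminal for the word `w`: the box to which the word leads from `b`, the one
above `b` or the one to the right of `b`, is not in `D`. -/
def IsTerminalBox (D : Finset (ℕ × ℕ)) (w : Finset ℤ) (b : ℕ × ℕ) : Prop :=
  b ∈ D ∧ (content b ∈ w → ∀ i : ℕ, i + 1 = b.1 → (i, b.2) ∉ D) ∧
    (content b ∉ w → (b.1, b.2 + 1) ∉ D)

open Classical in
/-- The contents of the boxes of `D` that are initial for `w`. -/
noncomputable def initialContents (D : Finset (ℕ × ℕ)) (w : Finset ℤ) : Finset ℤ :=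
  (D.filter (IsInitialBox D w)).image content

open Classical in
/-- The contents of the boxes of `D` that are terminal for `w`, increased by one: they are the upper
bounds of half-open intervals of contents. -/
noncomputable def terminalContents (D : Finset (ℕ × ℕ)) (w : Finset ℤ) : Finset ℤ :=
  (D.filter (IsTerminalBox D w)).image fun b => content b + 1

section words

variable {D : Finset (ℕ × ℕ)} {w : Finset ℤ} {c d : ℤ}

theorem mem_initialContents :
    d ∈ initialContents D w ↔ ∃ b, IsInitialBox D w b ∧ content b = d := by
  simp only [initialContents, Finset.mem_image, Finset.mem_filter]
  exact exists_congr fun b => ⟨fun h => ⟨h.1.2, h.2⟩, fun h => ⟨⟨h.1.1, h.1⟩, h.2⟩⟩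

theorem mem_terminalContents :
    d ∈ terminalContents D w ↔ ∃ b, IsTerminalBox D w b ∧ content b + 1 = d := by
  simp only [terminalContents, Finset.mem_image, Finset.mem_filter]
  exact exists_congr fun b => ⟨fun h => ⟨h.1.2, h.2⟩, fun h => ⟨⟨h.1.1, h.1⟩, h.2⟩⟩

/-- By convexity, only the last or the first box of a diagonal can be initial. -/
theorem IsInitialBox.unique (hD : IsSkewDiagram D) {a b : ℕ × ℕ} (ha : IsInitialBox D w a)
    (hb : IsInitialBox D w b) (hab : content a = content b) : a = b := by
  have key : ∀ a b : ℕ × ℕ, IsInitialBox D w a → IsInitialBox D w b → content a = content b →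
      ¬ a.1 < b.1 := by
    rintro ⟨x, y⟩ ⟨u, v⟩ ha hb hab hlt
    simp only [content] at hab
    by_cases hw : content (x, y) - 1 ∈ w
    · exact ha.2.1 hw (hD.convex ha.1 hb.1 (Prod.mk_le_mk.2 ⟨by omega, by omega⟩)
        (Prod.mk_le_mk.2 ⟨by omega, by omega⟩))
    · refine hb.2.2 ?_ (v - 1) (by simp only; omega) (hD.convex ha.1 hb.1
        (Prod.mk_le_mk.2 ⟨by omega, by omega⟩) (Prod.mk_le_mk.2 ⟨by omega, by omega⟩))
      simp only [content] at hw ⊢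
      rwa [← hab]
  have h1 := key a b ha hb hab
  have h2 := key b a hb ha hab.symm
  simp only [content] at hab
  ext <;> omega

theorem IsTerminalBox.unique (hD : IsSkewDiagram D) {a b : ℕ × ℕ} (ha : IsTerminalBox D w a)
    (hb : IsTerminalBox D w b) (hab : content a = content b) : a = b := by
  have key : ∀ a b : ℕ × ℕ, IsTerminalBox D w a → IsTerminalBox D w b → content a = content b →
      ¬ a.1 < b.1 := by
    rintro ⟨x, y⟩ ⟨u, v⟩ ha hb hab hlt
    by_cases hw : content (x, y) ∈ w
    · refine hb.2.1 (hab ▸ hw) (u - 1) (by simp only at *; omega) ?_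
      simp only [content] at hab
      exact hD.convex ha.1 hb.1
        (Prod.mk_le_mk.2 ⟨by omega, by omega⟩) (Prod.mk_le_mk.2 ⟨by omega, by omega⟩)
    · simp only [content] at hab
      exact ha.2.2 hw (hD.convex ha.1 hb.1 (Prod.mk_le_mk.2 ⟨by omega, by omega⟩)
        (Prod.mk_le_mk.2 ⟨by omega, by omega⟩))
  have h1 := key a b ha hb hab
  have h2 := key b a hb ha hab.symm
  simp only [content] at hab
  ext <;> omega

theorem mem_initialContents_insert_of_ne (hd : d ≠ c + 1) :
    d ∈ initialContents D (insert c w) ↔ d ∈ initialContents D w := by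
  rw [mem_initialContents, mem_initialContents]
  refine exists_congr fun b => and_congr_left fun hb => ?_
  rw [IsInitialBox, IsInitialBox, Finset.mem_insert, or_iff_right (by omega)]

theorem mem_terminalContents_insert_of_ne (hd : d ≠ c + 1) :
    d ∈ terminalContents D (insert c w) ↔ d ∈ terminalContents D w := by
  rw [mem_terminalContents, mem_terminalContents]
  refine exists_congr fun b => and_congr_left fun hb => ?_
  rw [IsTerminalBox, IsTerminalBox, Finset.mem_insert, or_iff_right (by omega)]

/-- The boxes on the diagonals `c` and `c + 1` form a chain of boxes with a common edge, in which
steps up and steps to the right alternate. Its lower right end lies on the diagonal `c + 1` and is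
initial for a word with a step up, or it lies on the diagonal `c` and is terminal for a word with a
step to the right. -/
theorem mem_initialContents_insert (hD : IsSkewDiagram D) (hc : c ∉ w) (hcD : c ∈ D.image content) :
    c + 1 ∈ initialContents D (insert c w) ↔ c + 1 ∉ terminalContents D w := by
  rw [mem_initialContents, mem_terminalContents]
  constructor
  · rintro ⟨⟨x, y⟩, ⟨h1, h2, -⟩, hxy⟩ ⟨⟨u, v⟩, ⟨h3, -, h4⟩, huv⟩
    have h2 := h2 (by rw [hxy]; simp)
    have huv : content (u, v) = c := by omega
    have h4 := h4 (by rwa [huv])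
    simp only [content] at hxy huv h2 h4
    rcases Nat.lt_or_ge x u with h | h
    · exact h2 (hD.convex h1 h3 (Prod.mk_le_mk.2 ⟨by omega, by omega⟩)
        (Prod.mk_le_mk.2 ⟨by omega, by omega⟩))
    · exact h4 (hD.convex h3 h1 (Prod.mk_le_mk.2 ⟨by omega, by omega⟩)
        (Prod.mk_le_mk.2 ⟨by omega, by omega⟩))
  · intro h
    by_contra hn
    obtain ⟨a, ha, hac⟩ := Finset.mem_image.1 hcD
    obtain ⟨⟨u, v⟩, hb, hmax⟩ := (D.filter fun b => content b = c).exists_max_image Prod.fst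
      ⟨a, Finset.mem_filter.2 ⟨ha, hac⟩⟩
    rw [Finset.mem_filter] at hb
    have h1 : (u, v + 1) ∈ D := by
      by_contra h1
      exact h ⟨(u, v), ⟨hb.1, fun h => absurd (hb.2 ▸ h) hc, fun _ => h1⟩, by rw [hb.2]⟩
    have hc1 : content (u, v + 1) = c + 1 := by
      have := hb.2
      simp only [content] at this ⊢
      push_cast
      omega
    have h2 : (u + 1, v + 1) ∈ D := by
      by_contra h2
      exact hn ⟨(u, v + 1), ⟨h1, fun _ => h2, fun h => absurd (by rw [hc1]; simp) h⟩, hc1⟩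
    have := hmax (u + 1, v + 1) (Finset.mem_filter.2 ⟨h2, by
      simp only [content] at hc1 ⊢
      push_cast at hc1 ⊢
      omega⟩)
    simp at this

theorem mem_terminalContents_insert (hD : IsSkewDiagram D) (hc : c ∉ w)
    (hcD : c ∈ D.image content) :
    c + 1 ∈ terminalContents D (insert c w) ↔ c + 1 ∉ initialContents D w := by
  rw [mem_initialContents, mem_terminalContents]
  constructor
  · rintro ⟨⟨u, v⟩, ⟨h3, h4, -⟩, huv⟩ ⟨⟨x, y⟩, ⟨h1, -, h2⟩, hxy⟩
    have h2 := h2 (by rw [hxy]; simpa using hc)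
    have huv : content (u, v) = c := by omega
    have h4 := h4 (by rw [huv]; simp)
    simp only [content] at hxy huv h2 h4
    rcases Nat.lt_or_ge x u with h | h
    · exact h4 (u - 1) (by omega) (hD.convex h1 h3 (Prod.mk_le_mk.2 ⟨by omega, by omega⟩)
        (Prod.mk_le_mk.2 ⟨by omega, by omega⟩))
    · exact h2 (y - 1) (by omega) (hD.convex h3 h1 (Prod.mk_le_mk.2 ⟨by omega, by omega⟩)
        (Prod.mk_le_mk.2 ⟨by omega, by omega⟩))
  · intro h
    by_contra hn
    obtain ⟨a, ha, hac⟩ := Finset.mem_image.1 hcD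
    obtain ⟨⟨u, v⟩, hb, hmin⟩ := (D.filter fun b => content b = c).exists_min_image Prod.fst
      ⟨a, Finset.mem_filter.2 ⟨ha, hac⟩⟩
    rw [Finset.mem_filter] at hb
    obtain ⟨i, hi, h1⟩ : ∃ i, i + 1 = u ∧ (i, v) ∈ D := by
      by_contra! h1
      exact hn ⟨(u, v), ⟨hb.1, fun _ => h1, fun h => absurd (by rw [hb.2]; simp) h⟩, by rw [hb.2]⟩
    have hb2 := hb.2
    have hc1 : content (i, v) = c + 1 := by
      simp only [content] at hb2 ⊢
      omega
    obtain ⟨j, hj, h2⟩ : ∃ j, j + 1 = v ∧ (i, j) ∈ D := by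
      by_contra! h2
      exact h ⟨(i, v), ⟨h1, fun h => absurd (by simpa [hc1] using h) hc, fun _ => h2⟩, hc1⟩
    have := hmin (i, j) (Finset.mem_filter.2 ⟨h2, by
      simp only [content] at hc1 ⊢
      omega⟩)
    simp only at this
    omega

end words

/-! ### Independence of the directions -/

/-- The Giambelli type matrix of a diagram `D` and a word `w`, with the rows indexed by the terminal
contents and the columns indexed by the initial contents. -/
noncomputable def wordMatrix (R : Type*) [CommRing R] (D : Finset (ℕ × ℕ)) (w : Finset ℤ) :
    Matrix (terminalContents D w) (initialContents D w) (symmFunctions R) :=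
  arraySubmatrix (fun p q => ⟨ribbonSchur R w p q, ribbonSchur_mem w p q⟩)
    (terminalContents D w) (initialContents D w)

theorem wordMatrix_insert (R : Type*) [CommRing R] {D : Finset (ℕ × ℕ)} (hD : IsSkewDiagram D)
    {w : Finset ℤ} {c : ℤ} (hc : c ∉ w) (hcD : c ∈ D.image content) :
    StablyEquivalentIndexed (wordMatrix R D w) (wordMatrix R D (insert c w)) := by
  have hT := isCornerTurn_ribbonSchur (R := R) hc
  have hi := mem_initialContents_insert hD hc hcD
  have ht := mem_terminalContents_insert hD hc hcD
  have hi' := fun d (hd : d ≠ c + 1) => mem_initialContents_insert_of_ne (D := D) (w := w) hd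
  have ht' := fun d (hd : d ≠ c + 1) => mem_terminalContents_insert_of_ne (D := D) (w := w) hd
  unfold wordMatrix
  generalize initialContents D w = I at *
  generalize initialContents D (insert c w) = I' at *
  generalize terminalContents D w = J at *
  generalize terminalContents D (insert c w) = J' at *
  by_cases hI : c + 1 ∈ I <;> by_cases hJ : c + 1 ∈ J
  · obtain rfl : I = insert (c + 1) I' := by
      ext d
      by_cases hd : d = c + 1
      · simp_all
      · simp [hi' d hd, hd]
    obtain rfl : J = insert (c + 1) J' := by
      ext d
      by_cases hd : d = c + 1
      · simp_all
      · simp [ht' d hd, hd]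
    exact (hT.symm.insert_insert (by simp [hi]) (by simp [ht])).symm
  · obtain rfl : I = I' := by
      ext d
      by_cases hd : d = c + 1
      · simp_all
      · exact (hi' d hd).symm
    obtain rfl : J = J' := by
      ext d
      by_cases hd : d = c + 1
      · simp_all
      · exact (ht' d hd).symm
    exact hT.of_mem_notMem hI hJ
  · obtain rfl : I = I' := by
      ext d
      by_cases hd : d = c + 1
      · simp_all
      · exact (hi' d hd).symm
    obtain rfl : J = J' := by
      ext d
      by_cases hd : d = c + 1
      · simp_all
      · exact (ht' d hd).symm
    exact hT.of_notMem_mem hI hJ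
  · obtain rfl : I' = insert (c + 1) I := by
      ext d
      by_cases hd : d = c + 1
      · simp_all
      · simp [hi' d hd, hd]
    obtain rfl : J' = insert (c + 1) J := by
      ext d
      by_cases hd : d = c + 1
      · simp_all
      · simp [ht' d hd, hd]
    exact hT.insert_insert hI hJ

/-- Turning the corners one by one, every word is reduced to the empty one. -/
theorem wordMatrix_empty (R : Type*) [CommRing R] {D : Finset (ℕ × ℕ)} (hD : IsSkewDiagram D)
    {w : Finset ℤ} (hw : w ⊆ D.image content) :
    StablyEquivalentIndexed (wordMatrix R D ∅) (wordMatrix R D w) := by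
  induction w using Finset.induction_on with
  | empty => exact .refl _
  | insert c w hc ih =>
    rw [Finset.insert_subset_iff] at hw
    exact (ih hw.2).trans (wordMatrix_insert R hD hc hw.1)

/-! ### Semistandard tableaux of border strips -/

theorem skewSchur_eq_fillingSeries (R : Type*) [CommRing R] (D : Finset (ℕ × ℕ)) :
    skewSchur R D = fillingSeries R (IsSemistandard D) := by
  ext α
  rw [coeff_fillingSeries]
  change ((Set.ncard _ : ℕ) : R) = _
  congr 1
  refine Nat.card_congr (Equiv.subtypeEquivRight fun T => ?_)
  simp only [Set.mem_ofPred_eq, Finsupp.ext_iff, fillingWeight_apply]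

/-- The steps of `φ` between consecutive contents are those prescribed by the word `w`. -/
def FollowsWord (φ : Finset (ℕ × ℕ)) (w : Finset ℤ) : Prop :=
  ∀ a ∈ φ, ∀ b ∈ φ, content b = content a + 1 →
    (content a ∈ w → a.1 = b.1 + 1 ∧ a.2 = b.2) ∧ (content a ∉ w → a.1 = b.1 ∧ b.2 = a.2 + 1)

/-- The segment of a border strip is semistandard if and only if each of its steps is: boxes in the
same row or column are joined by a sequence of steps in this row or column. -/
theorem segmentSchur_eq_ribbonSchur (R : Type*) [CommRing R] {φ : Finset (ℕ × ℕ)} {w : Finset ℤ}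
    (hφ : IsBorderStrip φ) (hw : FollowsWord φ w) {p q : ℤ}
    (hpq : ∀ c, p ≤ c → c ≤ q → c ∈ φ.image content) :
    segmentSchur R φ p q = ribbonSchur R w p (q + 1) := by
  rw [segmentSchur, ribbonSchur, skewSchur_eq_fillingSeries]
  congr 1
  have hmem : ∀ b : stripSegment φ p q, b.1 ∈ φ ∧ p ≤ content b ∧ content b ≤ q := fun b =>
    Finset.mem_filter.1 b.2
  let e : stripSegment φ p q ≃ Finset.Ico p (q + 1) := Equiv.ofBijective
    (fun b => ⟨content b, Finset.mem_Ico.2 ⟨(hmem b).2.1, by have := (hmem b).2.2; omega⟩⟩) (by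
      constructor
      · intro a b hab
        exact Subtype.ext (hφ.content_injOn (hmem a).1 (hmem b).1 (congrArg Subtype.val hab))
      · intro c
        have hc := Finset.mem_Ico.1 c.2
        obtain ⟨b, hb, hbc⟩ := Finset.mem_image.1 (hpq c hc.1 (by omega))
        exact ⟨⟨b, Finset.mem_filter.2 ⟨hb, by omega, by omega⟩⟩, Subtype.ext hbc⟩)
  have he : ∀ b, (e b).1 = content b := fun _ => rfl
  refine (fillingSeries_congr e fun t => ?_).symm
  constructor
  · intro ht
    have key : ∀ (k : ℕ) (a b : stripSegment φ p q), content b = content a + k →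
        b.1.1 ≤ a.1.1 ∧ a.1.2 ≤ b.1.2 ∧ (a.1.1 = b.1.1 → t (e a) ≤ t (e b)) ∧
          (a.1.2 = b.1.2 → t (e b) ≤ t (e a) ∧ (0 < k → t (e b) < t (e a))) := by
      intro k
      induction k with
      | zero =>
        intro a b hab
        obtain rfl : a = b := e.injective (Subtype.ext (by rw [he, he, hab]; simp))
        simp
      | succ k ih =>
        intro a b hab
        have hb := hmem b
        have ha := hmem a
        push_cast at hab
        obtain ⟨x, hx⟩ := e.surjective
          ⟨content a + k, Finset.mem_Ico.2 ⟨by omega, by omega⟩⟩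
        have hx : content x = content a + k := congrArg Subtype.val hx
        obtain ⟨h1, h2, h3, h4⟩ := ih a x hx
        have hstep := ht (e x) (e b) (by rw [he, he]; omega)
        have hdir := hw x (hmem x).1 b hb.1 (by omega)
        rw [he] at hstep
        by_cases hxw : content x ∈ w
        · rw [if_pos hxw] at hstep
          have := hdir.1 hxw
          refine ⟨by omega, by omega, fun _ => by omega, fun hab => ?_⟩
          have := (h4 (by omega)).1
          exact ⟨by omega, fun _ => by omega⟩
        · rw [if_neg hxw] at hstep
          have := hdir.2 hxw
          exact ⟨by omega, by omega, fun hab => (h3 (by omega)).trans hstep, fun _ => by omega⟩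
    constructor
    · intro a b h1 h2
      refine (key (b.1.2 - a.1.2) a b ?_).2.2.1 h1
      simp only [content]
      omega
    · intro a b h1 h2
      refine ((key (b.1.1 - a.1.1) b a ?_).2.2.2 h1.symm).2 (by omega)
      simp only [content]
      omega
  · intro ht c d hcd
    obtain ⟨a, rfl⟩ := e.surjective c
    obtain ⟨b, rfl⟩ := e.surjective d
    rw [he, he] at hcd
    have hdir := hw a (hmem a).1 b (hmem b).1 hcd
    rw [he]
    split_ifs with h
    · have := hdir.1 h
      exact ht.2 b a this.2.symm (by omega)
    · have := hdir.2 h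
      exact ht.1 a b this.1 (by omega)

/-! ### The word of an outside decomposition -/

theorem EdgewiseConnected.mem_image_content {D : Finset (ℕ × ℕ)} (hc : EdgewiseConnected D)
    {a b : ℕ × ℕ} (ha : a ∈ D) (hb : b ∈ D) {c : ℤ} (h1 : content a ≤ c) (h2 : c ≤ content b) :
    c ∈ D.image content := by
  rcases h2.lt_or_eq with h | h
  · obtain ⟨u, hu, -, -, -, hu', -⟩ := hc.exists_step ha hb h1 h
    exact Finset.mem_image.2 ⟨u, hu, hu'⟩
  · exact Finset.mem_image.2 ⟨b, hb, h.symm⟩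

/-- Of two adjacent boxes on consecutive diagonals, the second one is above the first one or to the
right of it. -/
theorem eq_or_eq_of_adj {a b : ℕ × ℕ} (h : boxGraph.Adj a b) (hab : content b = content a + 1) :
    (a.1 = b.1 + 1 ∧ a.2 = b.2) ∨ (a.1 = b.1 ∧ b.2 = a.2 + 1) := by
  rw [boxGraph_adj_iff] at h
  simp only [content] at hab
  omega

namespace OutsideDecomposition

variable {D : Finset (ℕ × ℕ)} {P : OutsideDecomposition D}

open Classical in
/-- The word of an outside decomposition: the contents of the boxes of `D` at which its strips go
up. -/
noncomputable def word (P : OutsideDecomposition D) : Finset ℤ :=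
  (D.image content).filter P.GoesUp

theorem mem_word {c : ℤ} : c ∈ P.word ↔ P.GoesUp c := by
  classical
  rw [word, Finset.mem_filter, and_iff_right_iff_imp]
  rintro (⟨x, y, h, -, hc, -⟩ | ⟨x, y, h, -, hc, -⟩) <;> exact Finset.mem_image.2 ⟨_, h, hc⟩

theorem word_subset : P.word ⊆ D.image content := by
  classical
  exact Finset.filter_subset _ _

theorem mem_of_mem_strip {k : Fin P.m} {b : ℕ × ℕ} (hb : b ∈ P.strip k) : b ∈ D := by
  rw [← P.cover]
  exact Finset.mem_biUnion.2 ⟨k, Finset.mem_univ k, hb⟩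

theorem joined_iff_of_up (hD : IsSkewDiagram D) {a b : ℕ × ℕ} (ha : a ∈ D) (hb : b ∈ D)
    (hab : a.1 = b.1 + 1 ∧ a.2 = b.2) : P.Joined a b ↔ content a ∈ P.word := by
  rcases a with ⟨x, y⟩
  rcases b with ⟨u, v⟩
  obtain ⟨rfl, rfl⟩ : x = u + 1 ∧ y = v := hab
  rw [mem_word]
  exact joined_up_iff hD ha hb

theorem joined_iff_of_right (hD : IsSkewDiagram D) {a b : ℕ × ℕ} (ha : a ∈ D) (hb : b ∈ D)
    (hab : a.1 = b.1 ∧ b.2 = a.2 + 1) : P.Joined a b ↔ content a ∉ P.word := by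
  rcases a with ⟨x, y⟩
  rcases b with ⟨u, v⟩
  obtain ⟨rfl, rfl⟩ : x = u ∧ v = y + 1 := hab
  rw [mem_word]
  exact joined_right_iff_not hD ha hb

theorem isInitialBox_iff (hD : IsSkewDiagram D) {k : Fin P.m} {b : ℕ × ℕ} (hb : b ∈ P.strip k) :
    IsInitialBox D P.word b ↔ ∀ c ∈ P.strip k, content b ≤ content c := by
  have hbD := mem_of_mem_strip hb
  constructor
  · rintro ⟨-, h1, h2⟩ c hc
    by_contra! hlt
    obtain ⟨u, hu, v, hv, hadj, hu', hv'⟩ :=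
      (P.isBorderStrip k).connected.exists_step (n := content b - 1) hc hb (by omega) (by omega)
    obtain rfl := (P.isBorderStrip k).content_injOn hv hb (by omega)
    have huD := mem_of_mem_strip hu
    rw [← hu'] at h1 h2
    rcases eq_or_eq_of_adj hadj (by omega) with h | h
    · rw [← h.1, ← h.2] at h1
      exact h1 ((joined_iff_of_up hD huD hbD h).1 ⟨k, hu, hv⟩) huD
    · refine h2 ((joined_iff_of_right hD huD hbD h).1 ⟨k, hu, hv⟩) u.2 h.2.symm ?_
      rwa [← h.1]
  · intro h
    have key : ∀ a, content a = content b - 1 → ¬ P.Joined a b := by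
      rintro a ha ⟨l, hl1, hl2⟩
      obtain rfl := P.strip_unique hl2 hb
      have := h a hl1
      omega
    refine ⟨hbD, fun hw hu => ?_, fun hw j hj hu => ?_⟩
    · have hc : content (b.1 + 1, b.2) = content b - 1 := by
        simp only [content]; push_cast; ring
      exact key _ hc ((joined_iff_of_up hD hu hbD ⟨rfl, rfl⟩).2 (hc ▸ hw))
    · have hc : content (b.1, j) = content b - 1 := by
        simp only [content]; omega
      exact key _ hc ((joined_iff_of_right hD hu hbD ⟨rfl, hj.symm⟩).2 (hc ▸ hw))

theorem isTerminalBox_iff (hD : IsSkewDiagram D) {k : Fin P.m} {b : ℕ × ℕ} (hb : b ∈ P.strip k) :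
    IsTerminalBox D P.word b ↔ ∀ c ∈ P.strip k, content c ≤ content b := by
  have hbD := mem_of_mem_strip hb
  constructor
  · rintro ⟨-, h1, h2⟩ c hc
    by_contra! hlt
    obtain ⟨u, hu, v, hv, hadj, hu', hv'⟩ :=
      (P.isBorderStrip k).connected.exists_step hb hc le_rfl hlt
    obtain rfl := (P.isBorderStrip k).content_injOn hu hb hu'
    have hvD := mem_of_mem_strip hv
    rcases eq_or_eq_of_adj hadj (by omega) with h | h
    · refine h1 ((joined_iff_of_up hD hbD hvD h).1 ⟨k, hu, hv⟩) v.1 h.1.symm ?_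
      rwa [h.2]
    · rw [h.1, ← h.2] at h2
      exact h2 ((joined_iff_of_right hD hbD hvD h).1 ⟨k, hu, hv⟩) hvD
  · intro h
    have key : ∀ a, content a = content b + 1 → ¬ P.Joined b a := by
      rintro a ha ⟨l, hl1, hl2⟩
      obtain rfl := P.strip_unique hl1 hb
      have := h a hl2
      omega
    refine ⟨hbD, fun hw i hi hu => ?_, fun hw hu => ?_⟩
    · refine key _ ?_ ((joined_iff_of_up hD hbD hu ⟨hi.symm, rfl⟩).2 hw)
      simp only [content]
      omega
    · refine key _ ?_ ((joined_iff_of_right hD hbD hu ⟨rfl, rfl⟩).2 hw)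
      simp only [content]
      push_cast
      ring

theorem exists_initialBox (k : Fin P.m) : ∃ b ∈ P.strip k, content b = P.initContent k ∧
    ∀ c ∈ P.strip k, content b ≤ content c := by
  obtain ⟨b, hb, h⟩ := Finset.exists_mem_eq_inf' (P.isBorderStrip k).nonempty content
  exact ⟨b, hb, h.symm, fun c hc => h ▸ Finset.inf'_le _ hc⟩

theorem exists_terminalBox (k : Fin P.m) : ∃ b ∈ P.strip k, content b = P.termContent k ∧
    ∀ c ∈ P.strip k, content c ≤ content b := by
  obtain ⟨b, hb, h⟩ := Finset.exists_mem_eq_sup' (P.isBorderStrip k).nonempty content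
  exact ⟨b, hb, h.symm, fun c hc => h ▸ Finset.le_sup' _ hc⟩

/-- The strips of an outside decomposition have distinct initial contents, and these are the
contents of the initial boxes for its word. -/
theorem exists_equiv_initialContents (hD : IsSkewDiagram D) :
    ∃ e : Fin P.m ≃ initialContents D P.word, ∀ k, (e k).1 = P.initContent k := by
  have hmem : ∀ k, P.initContent k ∈ initialContents D P.word := fun k => by
    obtain ⟨b, hb, h, hmin⟩ := P.exists_initialBox k
    exact mem_initialContents.2 ⟨b, (isInitialBox_iff hD hb).2 hmin, h⟩
  refine ⟨Equiv.ofBijective (fun k => ⟨P.initContent k, hmem k⟩) ⟨fun k l hkl => ?_, ?_⟩,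
    fun _ => rfl⟩
  · have hkl : P.initContent k = P.initContent l := congrArg Subtype.val hkl
    obtain ⟨a, ha, h, hmin⟩ := P.exists_initialBox k
    obtain ⟨b, hb, h', hmin'⟩ := P.exists_initialBox l
    obtain rfl := ((isInitialBox_iff hD ha).2 hmin).unique hD ((isInitialBox_iff hD hb).2 hmin')
      (by rw [h, h', hkl])
    exact P.strip_unique ha hb
  · rintro ⟨d, hd⟩
    obtain ⟨b, hb, rfl⟩ := mem_initialContents.1 hd
    obtain ⟨k, hk⟩ := P.exists_strip hb.1
    obtain ⟨a, ha, h, hmin⟩ := P.exists_initialBox k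
    have := (isInitialBox_iff hD hk).1 hb
    exact ⟨k, Subtype.ext (h.symm.trans (le_antisymm (hmin b hk) (this a ha)))⟩

theorem exists_equiv_terminalContents (hD : IsSkewDiagram D) :
    ∃ e : Fin P.m ≃ terminalContents D P.word, ∀ k, (e k).1 = P.termContent k + 1 := by
  have hmem : ∀ k, P.termContent k + 1 ∈ terminalContents D P.word := fun k => by
    obtain ⟨b, hb, h, hmax⟩ := P.exists_terminalBox k
    exact mem_terminalContents.2 ⟨b, (isTerminalBox_iff hD hb).2 hmax, by rw [h]⟩
  refine ⟨Equiv.ofBijective (fun k => ⟨P.termContent k + 1, hmem k⟩) ⟨fun k l hkl => ?_, ?_⟩,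
    fun _ => rfl⟩
  · have hkl : P.termContent k + 1 = P.termContent l + 1 := congrArg Subtype.val hkl
    obtain ⟨a, ha, h, hmax⟩ := P.exists_terminalBox k
    obtain ⟨b, hb, h', hmax'⟩ := P.exists_terminalBox l
    obtain rfl := ((isTerminalBox_iff hD ha).2 hmax).unique hD ((isTerminalBox_iff hD hb).2 hmax')
      (by omega)
    exact P.strip_unique ha hb
  · rintro ⟨d, hd⟩
    obtain ⟨b, hb, rfl⟩ := mem_terminalContents.1 hd
    obtain ⟨k, hk⟩ := P.exists_strip hb.1
    obtain ⟨a, ha, h, hmax⟩ := P.exists_terminalBox k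
    have := (isTerminalBox_iff hD hk).1 hb
    refine ⟨k, Subtype.ext ?_⟩
    simp only [← h, add_left_inj]
    exact le_antisymm (this a ha) (hmax b hk)

end OutsideDecomposition

/-! ### Giambelli type matrices -/

/-- A cutting strip has, on each diagonal of the diagram, the direction of the decomposition: since
the diagram is connected, any two consecutive diagonals contain a pair of adjacent boxes, to which
the defining rule of the cutting strip applies. -/
theorem IsCuttingStrip.followsWord {D : Finset (ℕ × ℕ)} {P : OutsideDecomposition D}
    {φ : Finset (ℕ × ℕ)} (h : IsCuttingStrip P φ) (hD : IsSkewDiagram D)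
    (hc : EdgewiseConnected D) : FollowsWord φ P.word := by
  intro a' ha' b' hb' hab'
  obtain ⟨x, hx, hxa⟩ := Finset.mem_image.1 (h.contents ▸ Finset.mem_image_of_mem content ha')
  obtain ⟨y, hy, hyb⟩ := Finset.mem_image.1 (h.contents ▸ Finset.mem_image_of_mem content hb')
  obtain ⟨a, ha, b, hb, hadj, hac, hbc⟩ := hc.exists_step hx hy hxa.le (by omega)
  obtain ⟨u, hu, v, hv, hadj', huc, hvc⟩ :=
    h.isBorderStrip.connected.exists_step ha' hb' le_rfl (by omega)
  obtain rfl := h.isBorderStrip.content_injOn hu ha' huc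
  obtain rfl := h.isBorderStrip.content_injOn hv hb' (by omega)
  have hrule := h.rule a ha b hb hadj (by omega) u hu v hv hac.symm (by omega)
  have h2 := eq_or_eq_of_adj hadj' hvc
  rw [← hac]
  rcases eq_or_eq_of_adj hadj (by omega) with h1 | h1
  · rw [OutsideDecomposition.joined_iff_of_up hD ha hb h1, SameRelativePosition] at hrule
    rw [hrule]
    omega
  · rw [OutsideDecomposition.joined_iff_of_right hD ha hb h1, SameRelativePosition] at hrule
    rw [hrule, ← not_not (a := content a ∈ P.word), hrule]
    omega

/-- Up to the order of rows and columns, the Giambelli type matrix is the matrix of the word of the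
decomposition. -/
theorem exists_stablyEquivalent_wordMatrix (R : Type*) [CommRing R] {D : Finset (ℕ × ℕ)}
    (hD : IsSkewDiagram D) (hc : EdgewiseConnected D) (P : OutsideDecomposition D)
    {φ : Finset (ℕ × ℕ)} (hφ : IsCuttingStrip P φ) :
    ∃ N : Matrix (Fin P.m) (Fin P.m) (symmFunctions R),
      N.map Subtype.val = giambelliMatrix R P φ ∧
        StablyEquivalentIndexed (wordMatrix R D P.word) N := by
  obtain ⟨e, he⟩ := P.exists_equiv_initialContents hD
  obtain ⟨f, hf⟩ := P.exists_equiv_terminalContents hD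
  refine ⟨(wordMatrix R D P.word).submatrix f e, ?_, .submatrix _ f e⟩
  ext1 i j
  obtain ⟨a, ha, haj, -⟩ := P.exists_initialBox j
  obtain ⟨b, hb, hbi, -⟩ := P.exists_terminalBox i
  rw [giambelliMatrix, Matrix.of_apply, segmentSchur_eq_ribbonSchur R hφ.isBorderStrip
    (hφ.followsWord hD hc) fun c h1 h2 => hφ.contents ▸ hc.mem_image_content
      (P.mem_of_mem_strip ha) (P.mem_of_mem_strip hb) (haj ▸ h1) (hbi ▸ h2), ← he, ← hf]
  rfl

theorem mainTheorem2 (R : Type*) [CommRing R] (lam mu : YoungDiagram) (hle : mu ≤ lam)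
    (hconn : EdgewiseConnected (skewCells lam mu))
    (P P' : OutsideDecomposition (skewCells lam mu)) (φ φ' : Finset (ℕ × ℕ))
    (hφ : IsCuttingStrip P φ) (hφ' : IsCuttingStrip P' φ') :
    StablyEquivalentOver (symmFunctions R) (giambelliMatrix R P φ) (giambelliMatrix R P' φ') := by
  have hD : IsSkewDiagram (skewCells lam mu) := ⟨lam, mu, hle, rfl⟩
  obtain ⟨N, hN, h⟩ := exists_stablyEquivalent_wordMatrix R hD hconn P hφ
  obtain ⟨N', hN', h'⟩ := exists_stablyEquivalent_wordMatrix R hD hconn P' hφ'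
  refine ⟨N, N', hN, hN', StablyEquivalentIndexed.stablyEquivalent ?_⟩
  exact ((wordMatrix_empty R hD P.word_subset).trans h).symm.trans
    ((wordMatrix_empty R hD P'.word_subset).trans h')
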